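/- **Setting.** Let $\mathcal X$ be a set of sequences $X=(x_t)_{t\in\mathbb Z}$ in $\mathbb R^d$ with $\|x_t\|_2\le 1$, let $\mathcal S=\{x_t: X\in\mathcal X,\ t\in\mathbb Z\}$ be the set of occurring tokens, and write $|||F|||=\sup_{t}\sup_{X\in\mathcal X}|F_t(X)|$. Let $\sigma$ be the ReLU. For a function $f$ on a domain $S\subset\mathbb R^N$ the Barron norm is $\|f\|_{\mathcal B}=\inf_\rho \mathbb E_\rho[|a|(\|b\|_1+|c|)]$, the infimum over probability measures $\rho$ on $(a,b,c)\in\mathbb R\times\mathbb R^N\times\mathbb R$ with $f(x)=\mathbb E_\rho[a\,\sigma(b^\top x+c)]$ for $x\in S$. **Targets.** $\mathbf H_t(X)=f(x_t,x_{t-g_1(x_t)},\dots,x_{t-g_M(x_t)})$, where the $g_i$ take positive integer values on $\mathcal S$ with $1\le g_i\le T_i$ and $\|g_i\|_{\mathcal B}<\infty$ on $\mathcal S$, and $f$ has $\|f\|_{\mathcal B}<\infty$ and Euclidean Lipschitz constant $\|f\|_{\rm Lip}<\infty$ on the product of $M+1$ closed unit balls of $\mathbb R^d$. **TMX Transformers.**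 Let $\phi_{\rm lin}(z)=-z$ for $z\ge0$, $\phi_{\log}(z)=-\log z$ for $z\ge1$, and $-\infty$ otherwise. A two-layer, $H$-head, $m$-width, normalization-free TMX Transformer with $\texttt{type}\in\{{\rm lin},\log\}$ and embedding dimension $D$ computes $$x^{(0)}_t=W_Ex_t+b_E,\quad x^{(1/2)}=x^{(0)}+\mathrm{Attn}^{(1)}(x^{(0)}),\quad x^{(1)}=x^{(1/2)}+\widetilde{\mathrm{FFN}}{}^{(1)}(x^{(1/2)}),$$ $$x^{(3/2)}=x^{(1)}+\mathrm{Attn}^{(2)}(x^{(1)}),\quad \mathbf{TF}_t(X)=\mathrm{FFN}^{(2)}(x^{(3/2)}_t)\in\mathbb R,$$ where $$\mathrm{Attn}_t(X)=W_O\sum_{h=1}^H W_V^{h}\sum_{s\ge0}x_{t-s}\exp\!\Big(p^h\big(\phi_{\texttt{type}}(s)-\phi_{\texttt{type}}((w^h)^\top x_t)\big)\Big),\qquad p^h>0,\ w^h\in\mathbb R^D,$$ each $\mathrm{FFN}(x)=\sum_{k=1}^m a_k\sigma(b_k^\top x+c_k)$ has $m$ neurons, and $\widetilde{\mathrm{FFN}}=[\mathrm{FFN}]$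 (lin) or $\log[\exp(\mathrm{FFN})]$ (log) coordinatewise, $[\cdot]$ being rounding to the nearest integer. (So the term $\langle W_Qx_t,W_Kx_{t-s}\rangle+p\,\phi(s)$ of the standard Transformer is replaced by $p(\phi(s)-\phi(w^\top x_t))$.) It is well defined on $\mathcal X$ if for all inputs and times every $\phi_{\texttt{type}}((w^h)^\top x_t)$ is finite, every sum over $s$ converges, and no logarithm of $0$ is taken. **Proposition.** (1) The attention score $p(\phi(s)-\phi(w^\top x_t))$ of one head has $D+1=\mathcal O(D)$ parameters. (2) There are absolute constants $C_{1},C_{2}>0$ and constants $C(n)>0$ depending only on $n$ such that the following holds for both types, all $d,M,\mathcal X$, every target $\mathbf H$ as above, and all integers $n,H,m\ge1$. If $$m\ \ge\ \begin{cases}C_{1}\sum_{i=1}^M\|g_i\|_{\mathcal B}^2,&\texttt{type}={\rm lin},\\ C_{1}\sum_{i=1}^M\|\log g_i\|_{\mathcal B}^2\,T_i^2,&\texttt{type}=\log,\end{cases}$$ (Barron norms on $\mathcal S$), then there exist an embedding dimension $D$ and a two-layer $H$-head $m$-width TMX Transformer $\mathbf{TF}$ of this type, well defined on $\mathcal X$,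 with $$|||\mathbf H-\mathbf{TF}|||\ \le\ C_{2}\sqrt{M+1}\,\frac{\|f\|_{\mathcal B}}{\sqrt m}+\|f\|_{\rm Lip}\cdot\begin{cases}\dfrac{C(n)}{H^n}\Big(\sum_{i=1}^M e^{0.01T_i}\Big)^{n+1},&\texttt{type}={\rm lin},\\[2mm] \dfrac{C(n)}{H^n}\Big(\sum_{i=1}^M T_i^{1.01}\Big)^{n+1},&\texttt{type}=\log.\end{cases}$$ -/

import Mathlib

open scoped NNReal ENNReal Matrix

noncomputable section

/-- `ℝ^d`-valued tokens, with the Euclidean norm. -/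
abbrev Token (d : ℕ) := EuclideanSpace ℝ (Fin d)

/-- Bi-infinite token sequences `X = (x_t)_{t ∈ ℤ}`. -/
abbrev TokenSeq (d : ℕ) := ℤ → Token d

/-- The ReLU activation. -/
def relu (z : ℝ) : ℝ := max z 0

/-! ### Barron norm, Lipschitz norm, sequence norm -/

/-- The Barron norm of `f` on the domain `S`: the infimum of `𝔼_ρ[|a| (‖b‖₁ + |c|)]` over all
Borel probability measures `ρ` of parameters `(a, b, c)` with `f(x) = 𝔼_ρ[a σ(bᵀx + c)]` for all
`x ∈ S`. It is `∞` exactly when no representation has a finite first moment; when the moment is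
finite, the representing integral converges absolutely and is continuous in `x`. -/
def barronNorm {ι : Type*} [Fintype ι] (S : Set (EuclideanSpace ℝ ι))
    (f : EuclideanSpace ℝ ι → ℝ) : ℝ≥0∞ :=
  ⨅ (ρ : MeasureTheory.Measure (ℝ × (ι → ℝ) × ℝ)) (_ : MeasureTheory.IsProbabilityMeasure ρ)
    (_ : ∀ x ∈ S, f x = ∫ θ, θ.1 * relu ((∑ i, θ.2.1 i * x i) + θ.2.2) ∂ρ),
    ∫⁻ θ, ENNReal.ofReal (|θ.1| * ((∑ i, |θ.2.1 i|) + |θ.2.2|)) ∂ρ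

/-- The best Lipschitz constant of `f` on `S` with respect to the Euclidean norm. -/
def lipNorm {ι : Type*} [Fintype ι] (S : Set (EuclideanSpace ℝ ι))
    (f : EuclideanSpace ℝ ι → ℝ) : ℝ≥0∞ :=
  ⨅ (K : ℝ≥0) (_ : LipschitzOnWith K f S), (K : ℝ≥0∞)

/-- `|||F||| = sup_t sup_{X ∈ 𝒳} |F_t(X)|`. -/
def tripleNorm {d : ℕ} (𝒳 : Set (TokenSeq d)) (F : ℤ → TokenSeq d → ℝ) : ℝ≥0∞ :=
  ⨆ (t : ℤ) (X : TokenSeq d) (_ : X ∈ 𝒳), ENNReal.ofReal |F t X|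

/-! ### Warm-up adaptive, long but sparse memories -/

/-- The tokens that occur in the input sequences. -/
def tokenSet {d : ℕ} (𝒳 : Set (TokenSeq d)) : Set (Token d) :=
  {x | ∃ X ∈ 𝒳, ∃ t : ℤ, X t = x}

/-- The product of `M + 1` closed Euclidean unit balls of `ℝ^d`, inside `ℝ^{(M+1)d}`. -/
def ballProduct (d M : ℕ) : Set (EuclideanSpace ℝ (Fin (M + 1) × Fin d)) :=
  {z | ∀ k, ‖(WithLp.toLp 2 (fun i => z (k, i)) : Token d)‖ ≤ 1}

/-- The concatenation `(u_0, …, u_M)` of `M + 1` tokens. -/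
def concatTokens {d M : ℕ} (u : Fin (M + 1) → Token d) :
    EuclideanSpace ℝ (Fin (M + 1) × Fin d) :=
  WithLp.toLp 2 (fun ki => u ki.1 ki.2)

/-- The target class: readout `f` in the Barron space and Lipschitz, memory functions `g_i` in the
Barron space, integer valued with `1 ≤ g_i ≤ T_i`. -/
structure AdaptiveTarget (d M : ℕ) (𝒳 : Set (TokenSeq d)) where
  f : EuclideanSpace ℝ (Fin (M + 1) × Fin d) → ℝ
  g : Fin M → Token d → ℕ
  T : Fin M → ℕ
  one_le_g : ∀ i, ∀ x ∈ tokenSet 𝒳, 1 ≤ g i x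
  g_le_T : ∀ i, ∀ x ∈ tokenSet 𝒳, g i x ≤ T i
  g_barron : ∀ i, barronNorm (tokenSet 𝒳) (fun x => (g i x : ℝ)) ≠ ∞
  f_barron : barronNorm (ballProduct d M) f ≠ ∞
  f_lipschitz : lipNorm (ballProduct d M) f ≠ ∞

/-- `H_t(X) = f(x_t, x_{t - g_1(x_t)}, …, x_{t - g_M(x_t)})`. -/
def AdaptiveTarget.eval {d M : ℕ} {𝒳 : Set (TokenSeq d)} (A : AdaptiveTarget d M 𝒳)
    (t : ℤ) (X : TokenSeq d) : ℝ :=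
  A.f (concatTokens (Fin.cons (X t) (fun i => X (t - (A.g i (X t) : ℤ)))))

/-! ### The TMX Transformer -/

/-- The two types of relative positional encoding. -/
inductive RPEType
  | lin
  | log

/-- `φ_lin(z) = -z` for `z ≥ 0` and `φ_log(z) = -log z` for `z ≥ 1`; both are `-∞` otherwise. -/
def RPEType.phi : RPEType → ℝ → EReal
  | .lin, z => if 0 ≤ z then ((-z : ℝ) : EReal) else ⊥
  | .log, z => if 1 ≤ z then ((-Real.log z : ℝ) : EReal) else ⊥

/-- The parameters `(p, w) ∈ ℝ × ℝ^D` of the attention score of one head. -/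
abbrev TMXScoreParams (D : ℕ) := ℝ × (Fin D → ℝ)

/-- The score `p (φ(s) - φ(wᵀ x_t))`; here `y` is the current token `x_t`. -/
def tmxScore {D : ℕ} (type : RPEType) (q : TMXScoreParams D) (y : Fin D → ℝ) (s : ℕ) : EReal :=
  (q.1 : EReal) * (type.phi (s : ℝ) - type.phi (q.2 ⬝ᵥ y))

/-- The unnormalized attention weight `exp (p (φ(s) - φ(wᵀ x_t)))`. -/
def tmxWeight {D : ℕ} (type : RPEType) (q : TMXScoreParams D) (y : Fin D → ℝ) (s : ℕ) : ℝ :=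
  (EReal.exp (tmxScore type q y s)).toReal

/-- One attention layer with `H` heads in dimension `D`: score parameters `(p, w)` and value matrix
of each head, and the output matrix. -/
structure TMXAttn (D H : ℕ) where
  score : Fin H → TMXScoreParams D
  WV : Fin H → Matrix (Fin D) (Fin D) ℝ
  WO : Matrix (Fin D) (Fin D) ℝ

/-- The normalization-free attention
`Attn_t(X) = W_O ∑_h W_V^h ∑_{s ≥ 0} exp (p^h (φ(s) - φ(w^hᵀ x_t))) x_{t-s}`. -/
def TMXAttn.eval {D H : ℕ} (type : RPEType) (A : TMXAttn D H) (X : ℤ → Fin D → ℝ) (t : ℤ) :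
    Fin D → ℝ :=
  A.WO *ᵥ ∑ h, A.WV h *ᵥ ∑' s : ℕ, tmxWeight type (A.score h) (X t) s • X (t - (s : ℤ))

/-- The attention layer is well defined at time `t` of `X`: `p > 0`, the score has no infinite
subtrahend, and the sum over the past converges. -/
def TMXAttn.WellDefined {D H : ℕ} (type : RPEType) (A : TMXAttn D H) (X : ℤ → Fin D → ℝ)
    (t : ℤ) : Prop :=
  ∀ h, 0 < (A.score h).1 ∧ type.phi ((A.score h).2 ⬝ᵥ X t) ≠ ⊥ ∧
    Summable (fun s : ℕ => tmxWeight type (A.score h) (X t) s • X (t - (s : ℤ)))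

/-- A two-layer ReLU network with `m` neurons from `ℝ^D` to `ℝ^E`. -/
structure FFN (D E m : ℕ) where
  a : Fin m → Fin E → ℝ
  b : Fin m → Fin D → ℝ
  c : Fin m → ℝ

/-- `FFN(x) = ∑_k a_k σ(b_kᵀ x + c_k)`. -/
def FFN.eval {D E m : ℕ} (F : FFN D E m) (x : Fin D → ℝ) : Fin E → ℝ :=
  ∑ k, relu (F.b k ⬝ᵥ x + F.c k) • F.a k

/-- Precision of the network output, coordinatewise: `[z]` for `lin` and `log [exp z]` for `log`,
where `[·]` is rounding to the nearest integer. -/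
def RPEType.precision : RPEType → ℝ → ℝ
  | .lin, z => (round z : ℝ)
  | .log, z => Real.log (round (Real.exp z) : ℝ)

/-- The logarithm in `log [exp z]` must not be taken at `0`. -/
def RPEType.PrecisionDefined : RPEType → ℝ → Prop
  | .lin, _ => True
  | .log, z => round (Real.exp z) ≠ 0

/-- A two-layer, `H`-head, `m`-width TMX Transformer with embedding dimension `D`; the second
network is the scalar readout. -/
structure TMXTransformer (d D H m : ℕ) where
  WE : Matrix (Fin D) (Fin d) ℝ
  bE : Fin D → ℝ
  attn₁ : TMXAttn D H
  ffn₁ : FFN D D m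
  attn₂ : TMXAttn D H
  ffn₂ : FFN D 1 m

namespace TMXTransformer

variable {d D H m : ℕ}

/-- `x_t^{(0)} = W_E x_t + b_E`. -/
def x0 (N : TMXTransformer d D H m) (X : TokenSeq d) (t : ℤ) : Fin D → ℝ :=
  N.WE *ᵥ (fun i => X t i) + N.bE

/-- `x_t^{(1/2)} = x_t^{(0)} + Attn_t^{(1)}(X^{(0)})`. -/
def xHalf (N : TMXTransformer d D H m) (type : RPEType) (X : TokenSeq d) (t : ℤ) : Fin D → ℝ :=
  N.x0 X t + N.attn₁.eval type (N.x0 X) t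

/-- `x_t^{(1)}`: residual block with the first network, with precision. -/
def x1 (N : TMXTransformer d D H m) (type : RPEType) (X : TokenSeq d) (t : ℤ) : Fin D → ℝ :=
  N.xHalf type X t + fun j => type.precision (N.ffn₁.eval (N.xHalf type X t) j)

/-- `x_t^{(3/2)} = x_t^{(1)} + Attn_t^{(2)}(X^{(1)})`. -/
def xThreeHalf (N : TMXTransformer d D H m) (type : RPEType) (X : TokenSeq d) (t : ℤ) :
    Fin D → ℝ :=
  N.x1 type X t + N.attn₂.eval type (N.x1 type X) t

/-- The output `x_t^{(2)} = FFN^{(2)}(x_t^{(3/2)}) ∈ ℝ`. -/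
def eval (N : TMXTransformer d D H m) (type : RPEType) (t : ℤ) (X : TokenSeq d) : ℝ :=
  N.ffn₂.eval (N.xThreeHalf type X t) 0

/-- Every expression in the definition of the Transformer is meaningful on all inputs in `𝒳`. -/
def WellDefined (N : TMXTransformer d D H m) (type : RPEType) (𝒳 : Set (TokenSeq d)) : Prop :=
  ∀ X ∈ 𝒳, ∀ t : ℤ,
    N.attn₁.WellDefined type (N.x0 X) t ∧
    (∀ j, type.PrecisionDefined (N.ffn₁.eval (N.xHalf type X t) j)) ∧
    N.attn₂.WellDefined type (N.x1 type X) t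

end TMXTransformer

/-! ### The quantities in the approximation rate -/

/-- `∑_i ‖g_i‖_𝓑²` for `lin` and `∑_i ‖log g_i‖_𝓑² T_i²` for `log`. -/
def AdaptiveTarget.widthBound {d M : ℕ} {𝒳 : Set (TokenSeq d)} (A : AdaptiveTarget d M 𝒳) :
    RPEType → ℝ≥0∞
  | .lin => ∑ i, barronNorm (tokenSet 𝒳) (fun x => (A.g i x : ℝ)) ^ 2
  | .log => ∑ i, barronNorm (tokenSet 𝒳) (fun x => Real.log (A.g i x)) ^ 2 * (A.T i : ℝ≥0∞) ^ 2

/-- `H^{-n} (∑_i e^{0.01 T_i})^{n+1}` for `lin` and `H^{-n} (∑_i T_i^{1.01})^{n+1}` for `log`. -/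
def attnRate {M : ℕ} (T : Fin M → ℕ) (H n : ℕ) : RPEType → ℝ
  | .lin => (∑ i, Real.exp (0.01 * (T i : ℝ))) ^ (n + 1) / (H : ℝ) ^ n
  | .log => (∑ i, (T i : ℝ) ^ (1.01 : ℝ)) ^ (n + 1) / (H : ℝ) ^ n

end

/-! A head whose score is centred at `w · x_t = g` gives lag `s` the weight `kernelBase g s ^ p`.
The base is `exp (g - s)` or `g / s`, and equals `1` exactly at the wanted lag `s = g`. Heads with
exponents `p₀ + 0.01 h` therefore combine to `base ^ p₀ * Q (base ^ 0.01)`, where `Q` is an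
arbitrary polynomial of degree below the number of heads. A rescaled Chebyshev polynomial has `Q 1 =
1` and is tiny once its argument is separated from `1` (`exists_peak_polynomial`), while `base ^ p₀`
is summable with mass bounded by a multiple of the rate. So the combined kernel is close in `ℓ¹` to
the indicator of lag `g`, uniformly in `g ≤ T` (`RPEType.exists_memory_kernel`). Dividing by
slightly more than `1` makes it a contraction, so that retrieved tokens stay in the unit ball, and
sharing the `H` heads among the memories in proportion to their rates gives the attention error
(`RPEType.exists_head_allocation`).

The centre must be exactly `g_i (x_t)`, and the rounding in the first network provides this: an
approximation of `g_i`, or of `log g_i` to accuracy of order `1 / T_i`, is turned into quantities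
from which `g_i` is an affine function (`exists_memoryReadout`).

Both networks rest on approximating Barron functions by `m` neurons uniformly, at rate `m ^ (-1/2)`
with no dimension factor (`exists_network_of_barron`). Hahn–Banach places the function in a closed
convex hull of neurons in the sup norm. A convex combination is replaced by a long uniform average,
which is then halved repeatedly. Each halving keeps one neuron of every pair, chosen by signs whose
discrepancy is bounded through the contraction principle for Rademacher averages.

The embedding holds a constant, `M + 1` token slots and the precision units
(`TMXBlueprint.transformer`). The second attention fills the memory slots, and the last network
approximates `f` at the retrieved tokens. The Barron error is taken at the retrieved point, and the
Lipschitz constant of `f` carries it back to the true one. -/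

noncomputable section

/-! ### Peak polynomials -/

/-- Polynomials of degree `< H` with value `1` at `1`, decaying like every power of `L / (γ H)` on
the part of `[0, L]` at distance at least `γ` from `1`. -/
theorem exists_peak_polynomial (n : ℕ) : ∃ C : ℝ, 0 < C ∧ ∀ (L γ : ℝ) (H : ℕ), 1 ≤ L → 0 < γ →
    γ ≤ 1 → 1 ≤ H → ∃ Q : Polynomial ℝ, Q.natDegree < H ∧ Q.eval 1 = 1 ∧
      ∀ y, 0 ≤ y → y ≤ L → γ ≤ |y - 1| → |Q.eval y| ≤ C * (L / (γ * H)) ^ n := by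
  refine ⟨2 * Real.exp 1 * (n.factorial : ℝ) * 2 ^ n, by positivity, ?_⟩
  intro L γ H hL hγ hγ1 hH
  set θ : ℝ := γ / L with hθ
  have hL0 : 0 < L := by linarith
  have hθ0 : 0 < θ := by positivity
  have hθ1 : θ ≤ 1 := by rw [hθ, div_le_one hL0]; linarith
  have hcosh : Real.cosh θ ≤ 1 + θ ^ 2 := by
    have h1 := Real.cosh_le_exp_half_sq θ
    have h2 : |θ ^ 2 / 2| ≤ 1 := by
      rw [abs_of_nonneg (by positivity)]; nlinarith
    have h3 := Real.abs_exp_sub_one_le h2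
    rw [abs_of_nonneg (by positivity : (0:ℝ) ≤ θ ^ 2 / 2)] at h3
    have := (abs_le.mp h3).2
    linarith
  -- The Chebyshev polynomial will be composed with a quadratic, so its index is half the available
  -- degree.
  set k : ℕ := (H - 1) / 2 with hk
  have hkH : 2 * k < H := by omega
  have hHk : (H : ℝ) ≤ 2 * (k + 1) := by
    have : H ≤ 2 * (k + 1) := by omega
    exact_mod_cast this
  -- This quadratic takes the value `cosh θ > 1` only at `y = 1`. At distance between `γ` and `L`
  -- from `1` the subtracted term lies in `[2θ², 2]`, so `cosh θ ≤ 1 + θ²` puts the value in `[-1,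
  -- 1]`, where Chebyshev polynomials are bounded by `1`.
  set q : Polynomial ℝ := Polynomial.C (Real.cosh θ) -
    Polynomial.C (2 / L ^ 2) * (Polynomial.X - Polynomial.C 1) ^ 2 with hq
  have hqe : ∀ y, q.eval y = Real.cosh θ - 2 / L ^ 2 * (y - 1) ^ 2 := by
    intro y; simp [hq]
  have hTk : (Polynomial.Chebyshev.T ℝ k).eval (Real.cosh θ) = Real.cosh (k * θ) := by
    simp [Polynomial.Chebyshev.T_real_cosh]
  have hcpos : 0 < Real.cosh (k * θ) := Real.cosh_pos _
  refine ⟨Polynomial.C (Real.cosh (k * θ))⁻¹ * (Polynomial.Chebyshev.T ℝ k).comp q, ?_, ?_, ?_⟩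
  · refine lt_of_le_of_lt ?_ hkH
    refine (Polynomial.natDegree_C_mul_le _ _).trans ?_
    refine Polynomial.natDegree_comp_le.trans ?_
    rw [Polynomial.Chebyshev.natDegree_T, Int.natAbs_natCast, mul_comm]
    gcongr
    rw [hq]
    compute_degree
  · rw [Polynomial.eval_mul, Polynomial.eval_comp, hqe, Polynomial.eval_C]
    simp [hTk, hcpos.ne']
  · intro y hy0 hyL hyγ
    rw [Polynomial.eval_mul, Polynomial.eval_comp, hqe, Polynomial.eval_C, abs_mul,
      abs_of_pos (inv_pos.mpr hcpos)]
    have hsq1 : (y - 1) ^ 2 ≤ L ^ 2 := by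
      apply sq_le_sq'
      · linarith
      · linarith
    have hsq2 : γ ^ 2 ≤ (y - 1) ^ 2 := by
      rw [← sq_abs (y - 1)]; gcongr
    have hz1 : 2 / L ^ 2 * (y - 1) ^ 2 ≤ 2 := by
      rw [div_mul_eq_mul_div, div_le_iff₀ (by positivity)]; linarith
    have hz2 : 2 * θ ^ 2 ≤ 2 / L ^ 2 * (y - 1) ^ 2 := by
      rw [hθ, div_pow, div_mul_eq_mul_div, mul_div_assoc']
      gcongr
    have harg : |Real.cosh θ - 2 / L ^ 2 * (y - 1) ^ 2| ≤ 1 := by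
      have := Real.one_le_cosh θ
      rw [abs_le]; constructor
      · linarith
      · nlinarith
    have hT := Polynomial.Chebyshev.abs_eval_T_real_le_one (k : ℤ) harg
    have hch : Real.exp (k * θ) / 2 ≤ Real.cosh (k * θ) := by
      rw [Real.cosh_eq]
      have := Real.exp_pos (-(k * θ))
      linarith
    -- The exponential growth of `cosh (k θ)` is weakened to a power of order `n`. Using `k + 1`,
    -- which is at least `H / 2`, costs only a factor `e` because `θ ≤ 1`.
    have hfac := Real.pow_div_factorial_le_exp (((k : ℝ) + 1) * θ) (by positivity) n
    have hexp : Real.exp (((k : ℝ) + 1) * θ) ≤ Real.exp 1 * Real.exp (k * θ) := by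
      rw [← Real.exp_add]; apply Real.exp_le_exp.mpr; nlinarith
    have hHpos : (0 : ℝ) < H := by exact_mod_cast hH
    have hpow : ((H : ℝ) / 2 * θ) ^ n ≤ (((k : ℝ) + 1) * θ) ^ n := by
      gcongr; linarith
    have key : ((H : ℝ) / 2 * θ) ^ n ≤
        2 * Real.exp 1 * n.factorial * Real.cosh (k * θ) := by
      rw [div_le_iff₀ (by positivity)] at hfac
      calc _ ≤ _ := hpow
        _ ≤ _ := hfac
        _ ≤ (Real.exp 1 * (2 * Real.cosh (k * θ))) * n.factorial := by
          gcongr; refine hexp.trans ?_; gcongr; linarith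
        _ = _ := by ring
    calc (Real.cosh (k * θ))⁻¹ * _ ≤ (Real.cosh (k * θ))⁻¹ * 1 := by gcongr
      _ ≤ 2 * Real.exp 1 * n.factorial * 2 ^ n * (L / (γ * H)) ^ n := by
        have h0 : (0 : ℝ) < ((H : ℝ) / 2 * θ) ^ n := by positivity
        have : 2 * Real.exp 1 * n.factorial * 2 ^ n * (L / (γ * H)) ^ n =
            2 * Real.exp 1 * n.factorial / ((H : ℝ) / 2 * θ) ^ n := by
          rw [hθ, div_mul_div_comm, div_pow, div_pow, mul_pow, mul_pow, mul_pow]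
          field_simp
        rw [this, mul_one, le_div_iff₀ h0, inv_mul_le_iff₀ hcpos]
        linarith

/-! ### The attention kernel -/

/-- The unnormalized weight of lag `s` for `p = 1` when the score is centred at `g`. -/
def RPEType.kernelBase : RPEType → ℝ → ℕ → ℝ
  | .lin, g, s => Real.exp (-((s : ℝ) - g))
  | .log, g, s => g / s

/-- The contribution of a memory of length at most `T` to the approximation rate. -/
def RPEType.rate : RPEType → ℕ → ℝ
  | .lin, T => Real.exp (0.01 * (T : ℝ))
  | .log, T => (T : ℝ) ^ (1.01 : ℝ)

theorem attnRate_eq {M : ℕ} (T : Fin M → ℕ) (H n : ℕ) (type : RPEType) :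
    attnRate T H n type = (∑ i, type.rate (T i)) ^ (n + 1) / (H : ℝ) ^ n := by
  cases type <;> rfl

theorem RPEType.one_le_rate (type : RPEType) {T : ℕ} (hT : 1 ≤ T) : 1 ≤ type.rate T := by
  cases type
  · exact Real.one_le_exp (by positivity)
  · exact Real.one_le_rpow (by exact_mod_cast hT) (by norm_num)

theorem RPEType.kernelBase_nonneg (type : RPEType) {g : ℝ} (hg : 0 ≤ g) (s : ℕ) :
    0 ≤ type.kernelBase g s := by
  cases type
  · exact (Real.exp_pos _).le
  · exact div_nonneg hg (Nat.cast_nonneg s)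

theorem RPEType.kernelBase_self (type : RPEType) {g : ℕ} (hg : 1 ≤ g) :
    type.kernelBase g g = 1 := by
  cases type
  · simp [RPEType.kernelBase]
  · have : (g : ℝ) ≠ 0 := by positivity
    simp [RPEType.kernelBase, this]

theorem summable_exp_kernel {p : ℝ} (hp : 0 < p) (g : ℝ) :
    HasSum (fun s : ℕ => Real.exp (-((s : ℝ) - g)) ^ p)
      (Real.exp (p * g) * (1 - Real.exp (-p))⁻¹) := by
  have h : ∀ s : ℕ, Real.exp (-((s : ℝ) - g)) ^ p = Real.exp (p * g) * Real.exp (-p) ^ s := by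
    intro s
    rw [← Real.exp_mul, ← Real.exp_nat_mul, ← Real.exp_add]
    congr 1; ring
  simp_rw [h]
  exact (hasSum_geometric_of_lt_one (Real.exp_pos _).le
    (by simpa using hp)).mul_left _

theorem RPEType.summable_kernelBase (type : RPEType) {g : ℝ} (hg : 0 ≤ g) {p : ℝ} (hp : 1 < p) :
    Summable (fun s : ℕ => type.kernelBase g s ^ p) := by
  cases type
  · exact (summable_exp_kernel (by linarith) g).summable
  · have := (Real.summable_nat_rpow_inv.mpr hp).mul_left (g ^ p)
    refine this.congr fun s => ?_
    simp only [RPEType.kernelBase]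
    rw [Real.div_rpow hg (Nat.cast_nonneg s), div_eq_mul_inv]

/-- Integer lags differ from `g` by at least one, a relative gap of at least `1 / (g + 1) ≥ 1 /
(2T)`. Bernoulli's inequality for the concave power `0.01` passes this gap through the root. For `s
< g` it is applied to the reciprocal, together with `u⁻¹ ≥ 2 - u`. Lag `0` has base `0`. -/
theorem abs_div_rpow_sub_one_ge {T g s : ℕ} (hg : 1 ≤ g) (hgT : g ≤ T) (hs : s ≠ g) :
    (0.005 : ℝ) / T ≤ |((g : ℝ) / s) ^ (0.01 : ℝ) - 1| := by
  have hT1 : (1 : ℝ) ≤ T := by exact_mod_cast hg.trans hgT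
  have hg0 : (0 : ℝ) < g := by exact_mod_cast hg
  have hgT' : (g : ℝ) ≤ T := by exact_mod_cast hgT
  have hdiv : (0.005 : ℝ) / T ≤ 0.005 := div_le_self (by norm_num) hT1
  rcases Nat.eq_zero_or_pos s with h0 | hspos
  · subst h0
    rw [Nat.cast_zero, div_zero, Real.zero_rpow (by norm_num)]
    norm_num; norm_num at hdiv; linarith
  have hs0 : (0 : ℝ) < s := by exact_mod_cast hspos
  rcases lt_or_gt_of_ne hs with hlt | hgt
  · have hsg : (s : ℝ) + 1 ≤ g := by exact_mod_cast hlt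
    have h1 : ((s : ℝ) / g) ^ (0.01 : ℝ) ≤ 1 - 0.01 / g := by
      have hb := rpow_one_add_le_one_add_mul_self (s := -(1 / (g : ℝ))) (p := 0.01)
        (by rw [neg_le_neg_iff, div_le_one hg0]; linarith) (by norm_num) (by norm_num)
      refine (Real.rpow_le_rpow (by positivity) ?_ (by norm_num)).trans (hb.trans (le_of_eq ?_))
      · rw [div_le_iff₀ hg0]; field_simp; linarith
      · ring
    have h2 : ((g : ℝ) / s) ^ (0.01 : ℝ) = (((s : ℝ) / g) ^ (0.01 : ℝ))⁻¹ := by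
      rw [← Real.inv_rpow (by positivity), inv_div]
    have hu0 : 0 < ((s : ℝ) / g) ^ (0.01 : ℝ) := by positivity
    set u := ((s : ℝ) / g) ^ (0.01 : ℝ) with hu
    have hgd : 0.005 / (T : ℝ) ≤ 0.01 / g := by
      rw [div_le_div_iff₀ (by linarith) hg0]; nlinarith
    have h3 : 2 - u ≤ u⁻¹ := by
      rw [← one_div, le_div_iff₀ hu0]; nlinarith [sq_nonneg (u - 1)]
    rw [h2]
    refine le_trans ?_ (le_abs_self _)
    linarith
  · have hsg : (g : ℝ) + 1 ≤ s := by exact_mod_cast hgt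
    have h1 : ((g : ℝ) / s) ^ (0.01 : ℝ) ≤ 1 - 0.01 / (g + 1) := by
      have hb := rpow_one_add_le_one_add_mul_self (s := -(1 / ((g : ℝ) + 1))) (p := 0.01)
        (by rw [neg_le_neg_iff, div_le_one (by positivity)]; linarith) (by norm_num) (by norm_num)
      refine (Real.rpow_le_rpow (by positivity) ?_ (by norm_num)).trans (hb.trans (le_of_eq ?_))
      · rw [div_le_iff₀ hs0, ← sub_eq_add_neg, one_sub_div (by positivity), div_mul_eq_mul_div,
          le_div_iff₀ (by positivity)]
        nlinarith
      · ring
    have hgd : 0.005 / (T : ℝ) ≤ 0.01 / (g + 1) := by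
      rw [div_le_div_iff₀ (by linarith) (by positivity)]; nlinarith
    rw [abs_sub_comm]
    refine le_trans ?_ (le_abs_self _)
    linarith

/-- Consecutive lags differ by the factor `e ^ 0.01` whatever `g` is, so here the gap does not
shrink with the memory length. -/
theorem abs_exp_rpow_sub_one_ge {g s : ℕ} (hs : s ≠ g) :
    (0.005 : ℝ) ≤ |Real.exp (-((s : ℝ) - g)) ^ (0.01 : ℝ) - 1| := by
  rw [← Real.exp_mul]
  rcases lt_or_gt_of_ne hs with hlt | hgt
  · have hsg : (s : ℝ) + 1 ≤ g := by exact_mod_cast hlt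
    refine le_trans ?_ (le_abs_self _)
    have := Real.add_one_le_exp (-((s : ℝ) - g) * 0.01)
    linarith
  · have hsg : (g : ℝ) + 1 ≤ s := by exact_mod_cast hgt
    rw [abs_sub_comm]
    refine le_trans ?_ (le_abs_self _)
    have h1 : Real.exp (-((s : ℝ) - g) * 0.01) ≤ Real.exp (-0.01) :=
      Real.exp_le_exp.mpr (by linarith)
    have h0 : |(-0.01 : ℝ)| ≤ 1 := by norm_num [abs_le]
    have h2 : |Real.exp (-0.01) - 1 - (-0.01)| ≤ (-0.01 : ℝ) ^ 2 :=
      Real.abs_exp_sub_one_sub_id_le h0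
    have h3 := (abs_le.mp h2).2
    linarith

/-- The range and the gap around `1` of the kernel base at the exponent `0.01`. -/
theorem RPEType.kernelBase_gap (type : RPEType) {T : ℕ} (hT : 1 ≤ T) :
    ∃ L γ : ℝ, 1 ≤ L ∧ 0 < γ ∧ γ ≤ 1 ∧ L / γ = 200 * type.rate T ∧
      ∀ g s : ℕ, 1 ≤ g → g ≤ T → type.kernelBase g s ^ (0.01 : ℝ) ≤ L ∧
        (s ≠ g → γ ≤ |type.kernelBase g s ^ (0.01 : ℝ) - 1|) := by
  have hT1 : (1 : ℝ) ≤ T := by exact_mod_cast hT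
  cases type
  · refine ⟨Real.exp (0.01 * T), 0.005, Real.one_le_exp (by positivity), by norm_num,
      by norm_num, ?_, fun g s hg hgT => ⟨?_, abs_exp_rpow_sub_one_ge⟩⟩
    · simp only [RPEType.rate]; ring
    · have hgT' : (g : ℝ) ≤ T := by exact_mod_cast hgT
      have hs : (0 : ℝ) ≤ s := Nat.cast_nonneg s
      simp only [RPEType.kernelBase]
      rw [← Real.exp_mul]
      exact Real.exp_le_exp.mpr (by linarith)
  · refine ⟨(T : ℝ) ^ (0.01 : ℝ), 0.005 / T, Real.one_le_rpow hT1 (by norm_num), by positivity,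
      ?_, ?_, fun g s hg hgT => ⟨?_, abs_div_rpow_sub_one_ge hg hgT⟩⟩
    · rw [div_le_one (by linarith)]; linarith
    · simp only [RPEType.rate]
      rw [show (1.01 : ℝ) = 0.01 + 1 by norm_num, Real.rpow_add_one (by linarith)]
      field_simp
      norm_num
    · have hgT' : (g : ℝ) ≤ T := by exact_mod_cast hgT
      apply Real.rpow_le_rpow (RPEType.kernelBase_nonneg .log (Nat.cast_nonneg g) s) _ (by norm_num)
      rcases Nat.eq_zero_or_pos s with h0 | hs
      · simp only [RPEType.kernelBase, h0, Nat.cast_zero, div_zero]; linarith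
      · exact (div_le_self (Nat.cast_nonneg g) (by exact_mod_cast hs)).trans hgT'

/-- A summable power of the kernel base whose total mass is controlled by the rate. -/
theorem RPEType.exists_summable_exponent (type : RPEType) : ∃ p₀ B : ℝ, 0 < p₀ ∧ 0 < B ∧
    (∀ g p : ℝ, 0 ≤ g → p₀ ≤ p → Summable (fun s : ℕ => type.kernelBase g s ^ p)) ∧
    ∀ T g : ℕ, g ≤ T → ∑' s : ℕ, type.kernelBase g s ^ p₀ ≤ B * type.rate T := by
  cases type
  · refine ⟨0.01, (1 - Real.exp (-0.01))⁻¹, by norm_num, ?_, ?_, ?_⟩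
    · have : Real.exp (-0.01) < 1 := by rw [Real.exp_lt_one_iff]; norm_num
      exact inv_pos.mpr (by linarith)
    · exact fun g p _ hp => (summable_exp_kernel (by linarith) g).summable
    · intro T g hgT
      have hgT' : (g : ℝ) ≤ T := by exact_mod_cast hgT
      have : Real.exp (-0.01) < 1 := by rw [Real.exp_lt_one_iff]; norm_num
      simp only [RPEType.kernelBase, RPEType.rate]
      rw [(summable_exp_kernel (by norm_num) (g : ℝ)).tsum_eq, mul_comm]
      have := inv_pos.mpr (sub_pos.mpr this)
      gcongr
  · have hsum : Summable (fun s : ℕ => ((s : ℝ) ^ (1.01 : ℝ))⁻¹) :=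
      Real.summable_nat_rpow_inv.mpr (by norm_num)
    have hnn : ∀ s : ℕ, 0 ≤ ((s : ℝ) ^ (1.01 : ℝ))⁻¹ := fun s => by positivity
    refine ⟨1.01, ∑' s : ℕ, ((s : ℝ) ^ (1.01 : ℝ))⁻¹, by norm_num, ?_, ?_, ?_⟩
    · refine hsum.tsum_pos hnn 1 (by norm_num)
    · exact fun g p hg hp => RPEType.summable_kernelBase .log hg (by linarith)
    · intro T g hgT
      have hgT' : (g : ℝ) ≤ T := by exact_mod_cast hgT
      have h : ∀ s : ℕ, RPEType.log.kernelBase g s ^ (1.01 : ℝ) =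
          (g : ℝ) ^ (1.01 : ℝ) * ((s : ℝ) ^ (1.01 : ℝ))⁻¹ := by
        intro s
        simp only [RPEType.kernelBase]
        rw [Real.div_rpow (Nat.cast_nonneg g) (Nat.cast_nonneg s), div_eq_mul_inv]
      simp_rw [h]
      rw [tsum_mul_left, mul_comm]
      have : 0 ≤ ∑' s : ℕ, ((s : ℝ) ^ (1.01 : ℝ))⁻¹ := tsum_nonneg hnn
      simp only [RPEType.rate]
      gcongr

/-- `H` heads extract a single token: the combined kernel is close in `ℓ¹` to the indicator of the
lag `g`, uniformly over `1 ≤ g ≤ T`. -/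
theorem RPEType.exists_memory_kernel (type : RPEType) (n : ℕ) : ∃ C : ℝ, 0 < C ∧
    ∀ T H : ℕ, 1 ≤ T → 1 ≤ H → ∃ p α : Fin H → ℝ, (∀ h, 0 < p h) ∧
      (∀ h (g : ℝ), 0 ≤ g → Summable (fun s : ℕ => type.kernelBase g s ^ p h)) ∧
      ∀ g : ℕ, 1 ≤ g → g ≤ T →
        ∑' s : ℕ, |∑ h, α h * type.kernelBase g s ^ p h - if s = g then 1 else 0| ≤
          C * type.rate T ^ (n + 1) / (H : ℝ) ^ n := by
  obtain ⟨C, hC, hpeak⟩ := exists_peak_polynomial n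
  obtain ⟨p₀, B, hp₀, hB, hsum, hmass⟩ := type.exists_summable_exponent
  refine ⟨B * C * 200 ^ n, by positivity, fun T H hT hH => ?_⟩
  obtain ⟨L, γ, hL, hγ, hγ1, hLγ, hgap⟩ := type.kernelBase_gap hT
  obtain ⟨Q, hQd, hQ1, hQ⟩ := hpeak L γ H hL hγ hγ1 hH
  have hp : ∀ h : Fin H, p₀ ≤ p₀ + 0.01 * ((h : ℕ) : ℝ) := fun h => by
    have : (0 : ℝ) ≤ ((h : ℕ) : ℝ) := Nat.cast_nonneg _
    linarith
  -- Exponents in arithmetic progression turn the sum over heads into `base ^ p₀` times a polynomial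
  -- in `base ^ 0.01`, with the coefficients of `Q` as head weights.
  refine ⟨fun h => p₀ + 0.01 * ((h : ℕ) : ℝ), fun h => Q.coeff h, fun h => hp₀.trans_le (hp h),
    fun h g hg => hsum g _ hg (hp h), fun g hg hgT => ?_⟩
  have hg0 : (0 : ℝ) ≤ g := Nat.cast_nonneg g
  have hH0 : (0 : ℝ) < H := by exact_mod_cast hH
  have hker : ∀ s : ℕ, ∑ h : Fin H, Q.coeff h * type.kernelBase g s ^ (p₀ + 0.01 * ((h : ℕ) : ℝ)) =
      type.kernelBase g s ^ p₀ * Q.eval (type.kernelBase g s ^ (0.01 : ℝ)) := by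
    intro s
    have hk := type.kernelBase_nonneg hg0 s
    rw [Polynomial.eval_eq_sum_range' hQd, Finset.mul_sum,
      Fin.sum_univ_eq_sum_range (fun h => Q.coeff h * type.kernelBase g s ^ (p₀ + 0.01 * (h : ℝ)))]
    refine Finset.sum_congr rfl fun h _ => ?_
    rw [Real.rpow_add_of_nonneg hk hp₀.le (by positivity), Real.rpow_mul hk, Real.rpow_natCast]
    ring
  have hbound : ∀ s : ℕ, |∑ h : Fin H, Q.coeff h *
      type.kernelBase g s ^ (p₀ + 0.01 * ((h : ℕ) : ℝ)) - if s = g then 1 else 0| ≤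
      type.kernelBase g s ^ p₀ * (C * (L / (γ * H)) ^ n) := by
    intro s
    have hk := type.kernelBase_nonneg hg0 s
    have hLn : 0 ≤ C * (L / (γ * H)) ^ n := by positivity
    rw [hker]
    by_cases hs : s = g
    · subst hs
      rw [type.kernelBase_self hg]
      simp [hQ1, hLn]
    · rw [if_neg hs, sub_zero, abs_mul, abs_of_nonneg (Real.rpow_nonneg hk _)]
      gcongr
      exact hQ _ (Real.rpow_nonneg hk _) (hgap g s hg hgT).1 ((hgap g s hg hgT).2 hs)
  have hS := (hsum g p₀ hg0 le_rfl).mul_right (C * (L / (γ * H)) ^ n)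
  calc _ ≤ ∑' s : ℕ, type.kernelBase g s ^ p₀ * (C * (L / (γ * H)) ^ n) :=
        (hS.of_nonneg_of_le (fun s => abs_nonneg _) hbound).tsum_le_tsum hbound hS
    _ ≤ B * type.rate T * (C * (L / (γ * H)) ^ n) := by
        rw [tsum_mul_right]
        gcongr
        exact hmass T g hgT
    _ = B * C * 200 ^ n * type.rate T ^ (n + 1) / (H : ℝ) ^ n := by
        rw [← div_div, hLγ, div_pow, mul_pow]
        ring

/-- The memory kernel, normalized so that its total mass is at most `1`. -/
theorem RPEType.exists_contractive_kernel (type : RPEType) (n : ℕ) : ∃ C : ℝ, 0 < C ∧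
    ∀ T H : ℕ, 1 ≤ T → 1 ≤ H → ∃ p α : Fin H → ℝ, (∀ h, 0 < p h) ∧
      (∀ h (g : ℝ), 0 ≤ g → Summable (fun s : ℕ => type.kernelBase g s ^ p h)) ∧
      ∀ g : ℕ, 1 ≤ g → g ≤ T →
        ∑' s : ℕ, |∑ h, α h * type.kernelBase g s ^ p h| ≤ 1 ∧
        ∑' s : ℕ, |∑ h, α h * type.kernelBase g s ^ p h - if s = g then 1 else 0| ≤
          C * type.rate T ^ (n + 1) / (H : ℝ) ^ n := by
  obtain ⟨C, hC, hker⟩ := type.exists_memory_kernel n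
  refine ⟨2 * C, by positivity, fun T H hT hH => ?_⟩
  obtain ⟨p, α, hp, hsum, hbd⟩ := hker T H hT hH
  set ε : ℝ := C * type.rate T ^ (n + 1) / (H : ℝ) ^ n with hε
  have hrate := type.one_le_rate hT
  have hε0 : 0 ≤ ε := by positivity
  -- The kernel has `ℓ¹` mass at most `1 + ε`. Dividing by that number moves it by at most another
  -- `ε`, which accounts for the doubled constant.
  refine ⟨p, fun h => α h / (1 + ε), hp, hsum, fun g hg hgT => ?_⟩
  have hb := hbd g hg hgT
  set K : ℕ → ℝ := fun s => ∑ h, α h * type.kernelBase g s ^ p h with hK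
  set δ : ℕ → ℝ := fun s => if s = g then 1 else 0 with hδ
  have hKsum : Summable K :=
    summable_sum fun h _ => (hsum h g (Nat.cast_nonneg g)).mul_left (α h)
  have hδabs : ∀ s, |δ s| = δ s := fun s => by simp only [hδ]; split_ifs <;> simp
  have hδ1 : HasSum δ 1 := hasSum_ite_eq g 1
  have hdsum : Summable fun s => |K s - δ s| := (hKsum.sub hδ1.summable).abs
  have hK' : ∀ s, ∑ h, α h / (1 + ε) * type.kernelBase g s ^ p h = K s / (1 + ε) := fun s => by
    rw [hK, Finset.sum_div]
    exact Finset.sum_congr rfl fun h _ => by ring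
  have hpos : 0 < 1 + ε := by linarith
  simp_rw [hK']
  constructor
  · have h1 : ∀ s, |K s / (1 + ε)| ≤ (|K s - δ s| + δ s) / (1 + ε) := fun s => by
      rw [abs_div, abs_of_pos hpos]
      gcongr
      have := abs_add_le (K s - δ s) (δ s)
      rwa [sub_add_cancel, hδabs] at this
    have hs := (hdsum.add hδ1.summable).div_const (1 + ε)
    calc _ ≤ ∑' s, (|K s - δ s| + δ s) / (1 + ε) :=
          (hs.of_nonneg_of_le (fun s => abs_nonneg _) h1).tsum_le_tsum h1 hs
      _ = (∑' s, |K s - δ s| + 1) / (1 + ε) := by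
          rw [tsum_div_const, hdsum.tsum_add hδ1.summable, hδ1.tsum_eq]
      _ ≤ 1 := by
          rw [div_le_one hpos]; linarith
  · have h1 : ∀ s, |K s / (1 + ε) - δ s| ≤ |K s - δ s| + ε * δ s := fun s => by
      have : K s / (1 + ε) - δ s = ((K s - δ s) + (-(ε * δ s))) / (1 + ε) := by
        field_simp; ring
      rw [this, abs_div, abs_of_pos hpos, div_le_iff₀ hpos]
      have h2 := abs_add_le (K s - δ s) (-(ε * δ s))
      rw [abs_neg, abs_mul, hδabs, abs_of_nonneg hε0] at h2
      have h3 := abs_nonneg (K s - δ s)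
      have h4 : 0 ≤ δ s := hδabs s ▸ abs_nonneg _
      nlinarith [mul_nonneg hε0 h3, mul_nonneg hε0 (mul_nonneg hε0 h4)]
    have hs := hdsum.add (hδ1.summable.mul_left ε)
    calc _ ≤ ∑' s, (|K s - δ s| + ε * δ s) :=
          (hs.of_nonneg_of_le (fun s => abs_nonneg _) h1).tsum_le_tsum h1 hs
      _ = ∑' s, |K s - δ s| + ε := by
          rw [hdsum.tsum_add (hδ1.summable.mul_left ε), tsum_mul_left, hδ1.tsum_eq, mul_one]
      _ ≤ 2 * C * type.rate T ^ (n + 1) / (H : ℝ) ^ n := by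
          have : 2 * C * type.rate T ^ (n + 1) / (H : ℝ) ^ n = ε + ε := by rw [hε]; ring
          linarith

/-! ### Distribution of heads among the memories -/

/-- Objects indexed by `K` occupy some of the `m` available heads or neurons. An unoccupied place
sees `none` and is idle. -/
theorem sum_partialInv {K E : Type*} [Fintype K] [AddCommMonoid E] {m : ℕ} (f : K ↪ Fin m)
    (F : Option K → E) (h0 : F none = 0) :
    ∑ h, F (Function.partialInv f h) = ∑ k, F (some k) := by
  classical
  have hpi := f.injective.isPartialInv
  have hsome : ∀ k, Function.partialInv f (f k) = some k := fun k => (hpi k (f k)).mpr rfl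
  refine (Finset.sum_subset (Finset.subset_univ (Finset.univ.map f)) fun h _ hh => ?_).symm.trans ?_
  · rcases ho : Function.partialInv f h with _ | k
    · exact h0
    · exact absurd (Finset.mem_map.mpr ⟨k, Finset.mem_univ k, (hpi k h).mp ho⟩) hh
  · simp [hsome]

/-- Splitting `H` in proportion to the weights `r i ≥ 1`. -/
theorem exists_proportional_split {M : ℕ} (r : Fin M → ℝ) (hr : ∀ i, 1 ≤ r i) (H n : ℕ)
    (hH : 1 ≤ H) : ∃ k : Fin M → ℕ, ∑ i, k i ≤ H ∧ ∀ i,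
      (k i = 0 → 1 ≤ r i * ((∑ j, r j) / H) ^ n) ∧
      (1 ≤ k i → r i ^ (n + 1) / (k i : ℝ) ^ n ≤ 2 ^ n * (r i * ((∑ j, r j) / H) ^ n)) := by
  have hH0 : (0 : ℝ) < H := by exact_mod_cast hH
  set R := ∑ j, r j with hR
  have hR0 : 0 ≤ R := Finset.sum_nonneg fun i _ => by linarith [hr i]
  -- A zero share means `H * r i < R`, so the target error already exceeds `1`, the error of the
  -- zero kernel. A positive share loses at most a factor `2` to the floor.
  refine ⟨fun i => ⌊H * r i / R⌋₊, ?_, fun i => ?_⟩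
  · rcases hR0.eq_or_lt with h0 | hpos
    · simp [← h0]
    · have : ((∑ i, ⌊H * r i / R⌋₊ : ℕ) : ℝ) ≤ H := by
        push_cast
        calc ∑ i, ((⌊H * r i / R⌋₊ : ℕ) : ℝ) ≤ ∑ i, H * r i / R :=
              Finset.sum_le_sum fun i _ => Nat.floor_le (by have := hr i; positivity)
          _ = H := by
              rw [← Finset.sum_div, ← Finset.mul_sum, ← hR, mul_div_assoc, div_self hpos.ne',
                mul_one]
      exact_mod_cast this
  · have hri := hr i
    have hpos : 0 < R := by
      have : r i ≤ R := Finset.single_le_sum (f := r) (fun j _ => by linarith [hr j])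
        (Finset.mem_univ i)
      linarith
    constructor
    · intro h0
      have h1 : H * r i / R < 1 := Nat.floor_eq_zero.mp h0
      rw [div_lt_one hpos] at h1
      have h2 : 1 ≤ R / H := by rw [le_div_iff₀ hH0]; nlinarith
      have := one_le_pow₀ h2 (n := n)
      nlinarith
    · intro h1
      set k := ⌊H * r i / R⌋₊ with hk
      have hk1 : (1 : ℝ) ≤ k := by exact_mod_cast h1
      have hlt : H * r i / R < k + 1 := Nat.lt_floor_add_one _
      have h2 : r i / k ≤ 2 * (R / H) := by
        rw [div_lt_iff₀ hpos] at hlt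
        rw [div_le_iff₀ (by linarith), mul_assoc, div_mul_eq_mul_div, mul_div_assoc',
          le_div_iff₀ hH0]
        nlinarith
      calc r i ^ (n + 1) / (k : ℝ) ^ n = r i * (r i / k) ^ n := by rw [div_pow]; ring
        _ ≤ r i * (2 * (R / H)) ^ n := by gcongr
        _ = _ := by rw [mul_pow]; ring

/-- `H` heads extract `M` memories at the same time; head `h` is centred at the memory `own h`. -/
theorem RPEType.exists_head_allocation (type : RPEType) (n : ℕ) : ∃ C : ℝ, 0 < C ∧
    ∀ (M : ℕ) (T : Fin M → ℕ) (H : ℕ), (∀ i, 1 ≤ T i) → 1 ≤ H →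
      ∃ (own : Fin H → Option (Fin M)) (p : Fin H → ℝ) (α : Fin M → Fin H → ℝ) (ε : Fin M → ℝ),
        (∀ i h, α i h ≠ 0 → own h = some i) ∧ (∀ h, 0 < p h) ∧
        (∀ h (g : ℝ), 0 ≤ g → Summable (fun s : ℕ => type.kernelBase g s ^ p h)) ∧
        ∑ i, ε i ≤ C * attnRate T H n type ∧
        ∀ i (g : ℕ), 1 ≤ g → g ≤ T i →
          ∑' s : ℕ, |∑ h, α i h * type.kernelBase g s ^ p h| ≤ 1 ∧
          ∑' s : ℕ, |∑ h, α i h * type.kernelBase g s ^ p h - if s = g then 1 else 0| ≤ ε i := by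
  obtain ⟨C, hC, hker⟩ := type.exists_contractive_kernel n
  refine ⟨(C + 1) * 2 ^ n, by positivity, fun M T H hT hH => ?_⟩
  obtain ⟨k, hk, hsplit⟩ := exists_proportional_split (fun i => type.rate (T i))
    (fun i => type.one_le_rate (hT i)) H n hH
  have hex : ∀ i, ∃ p α : Fin (k i) → ℝ, (∀ h, 0 < p h) ∧
      (∀ h (g : ℝ), 0 ≤ g → Summable (fun s : ℕ => type.kernelBase g s ^ p h)) ∧
      ∀ g : ℕ, 1 ≤ g → g ≤ T i →
        ∑' s : ℕ, |∑ h, α h * type.kernelBase g s ^ p h| ≤ 1 ∧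
        ∑' s : ℕ, |∑ h, α h * type.kernelBase g s ^ p h - if s = g then 1 else 0| ≤
          (C + 1) * 2 ^ n * (type.rate (T i) * ((∑ j, type.rate (T j)) / H) ^ n) := by
    intro i
    have hX : 0 ≤ type.rate (T i) * ((∑ j, type.rate (T j)) / H) ^ n := by
      have h0 : ∀ j, 0 ≤ type.rate (T j) := fun j => by linarith [type.one_le_rate (hT j)]
      have := h0 i
      have := Finset.sum_nonneg fun j (_ : j ∈ Finset.univ) => h0 j
      positivity
    set X := type.rate (T i) * ((∑ j, type.rate (T j)) / H) ^ n with hXdef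
    have h2n : (1 : ℝ) ≤ 2 ^ n := one_le_pow₀ (by norm_num)
    rcases Nat.eq_zero_or_pos (k i) with h0 | hpos
    · have hemp : IsEmpty (Fin (k i)) := by rw [h0]; infer_instance
      refine ⟨fun _ => 0, fun _ => 0, fun h => hemp.elim h, fun h => hemp.elim h,
        fun g hg hgT => ?_⟩
      have h1 := (hsplit i).1 h0
      have h2 : ∀ s : ℕ, |(0 : ℝ) - if s = g then 1 else 0| = if s = g then 1 else 0 :=
        fun s => by split_ifs <;> simp
      simp only [Finset.univ_eq_empty, Finset.sum_empty, h2, abs_zero, tsum_zero, tsum_ite_eq]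
      refine ⟨zero_le_one, h1.trans ?_⟩
      have : 1 ≤ (C + 1) * 2 ^ n := by nlinarith
      exact le_mul_of_one_le_left hX this
    · obtain ⟨p, α, hp, hs, hb⟩ := hker (T i) (k i) (hT i) hpos
      refine ⟨p, α, hp, hs, fun g hg hgT => ⟨(hb g hg hgT).1, (hb g hg hgT).2.trans ?_⟩⟩
      rw [mul_div_assoc, mul_assoc]
      have := (hsplit i).2 hpos
      have h3 : 0 ≤ 2 ^ n * X := by positivity
      nlinarith
  choose p α hp hs hb using hex
  have hcard : Fintype.card (Σ i, Fin (k i)) ≤ Fintype.card (Fin H) := by simpa using hk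
  obtain ⟨f⟩ := Function.Embedding.nonempty_of_card_le hcard
  have hsum : ∀ i (g : ℕ) (s : ℕ),
      ∑ h, ((Function.partialInv f h).elim 0 fun σ => if σ.1 = i then α σ.1 σ.2 else 0) *
        type.kernelBase g s ^ ((Function.partialInv f h).elim 2 fun σ => p σ.1 σ.2) =
      ∑ h, α i h * type.kernelBase g s ^ p i h := by
    intro i g s
    rw [sum_partialInv f (fun o => (o.elim 0 fun σ => if σ.1 = i then α σ.1 σ.2 else 0) *
        type.kernelBase g s ^ (o.elim 2 fun σ => p σ.1 σ.2)) (by simp), Fintype.sum_sigma]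
    simp only [Option.elim_some]
    rw [Finset.sum_eq_single i]
    · simp
    · intro j _ hj; simp [hj]
    · simp
  -- Spare heads get coefficient `0` and exponent `2`, a value for which the kernel is summable in
  -- both types.
  refine ⟨fun h => (Function.partialInv f h).map Sigma.fst,
    fun h => (Function.partialInv f h).elim 2 fun σ => p σ.1 σ.2,
    fun i h => (Function.partialInv f h).elim 0 fun σ => if σ.1 = i then α σ.1 σ.2 else 0,
    fun i => (C + 1) * 2 ^ n * (type.rate (T i) * ((∑ j, type.rate (T j)) / H) ^ n),
    ?_, ?_, ?_, ?_, ?_⟩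
  · intro i h hne
    rcases ho : Function.partialInv f h with _ | σ
    · simp [ho] at hne
    · simp only [ho, Option.elim_some, ne_eq, ite_eq_right_iff, Classical.not_imp] at hne
      simp only [ho, Option.map_some, hne.1]
  · intro h
    rcases ho : Function.partialInv f h with _ | σ
    · simp only [ho, Option.elim_none]; norm_num
    · simp only [ho, Option.elim_some]; exact hp _ _
  · intro h g hg
    rcases ho : Function.partialInv f h with _ | σ
    · simp only [ho, Option.elim_none]; exact type.summable_kernelBase hg one_lt_two
    · simp only [ho, Option.elim_some]; exact hs _ _ g hg
  · rw [attnRate_eq, ← Finset.mul_sum, ← Finset.sum_mul]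
    refine le_of_eq ?_
    rw [div_pow]; ring
  · intro i g hg hgT
    simp_rw [hsum]
    exact hb i g hg hgT

/-! ### Rademacher averages -/

/-- The sign `±1` of a Boolean. -/
def boolSign (b : Bool) : ℝ := if b then 1 else -1

@[simp] theorem boolSign_true : boolSign true = 1 := rfl

@[simp] theorem boolSign_false : boolSign false = -1 := rfl

theorem abs_boolSign (b : Bool) : |boolSign b| = 1 := by cases b <;> simp [boolSign]

theorem sum_bool_vector_succ {E : Type*} [AddCommMonoid E] {n : ℕ}
    (F : (Fin (n + 1) → Bool) → E) :
    ∑ ε, F ε = ∑ ε : Fin n → Bool, (F (Fin.cons true ε) + F (Fin.cons false ε)) := by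
  rw [← (Fin.consEquiv fun _ => Bool).sum_comp, Fintype.sum_prod_type, Fintype.sum_bool,
    ← Finset.sum_add_distrib]
  rfl

/-- For fixed `x` and `y` the left side is at most `F x + F y + |u x - u y|`. Either sign of the
absolute value is admissible on the right, since the roles of `x` and `y` may be exchanged. This is
the contraction principle for a single sign. -/
theorem iSup_contraction {X : Type*} [Nonempty X] (F u : X → ℝ) (φ : ℝ → ℝ)
    (hφ : ∀ a b, |φ a - φ b| ≤ |a - b|) (h1 : BddAbove (Set.range fun x => F x + u x))
    (h2 : BddAbove (Set.range fun x => F x - u x)) :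
    (⨆ x, (F x + φ (u x))) + (⨆ x, (F x - φ (u x))) ≤ (⨆ x, (F x + u x)) + ⨆ x, (F x - u x) := by
  rw [← le_sub_iff_add_le]
  refine ciSup_le fun x => ?_
  rw [le_sub_comm]
  refine ciSup_le fun y => ?_
  have hx1 := le_ciSup h1 x
  have hy1 := le_ciSup h1 y
  have hx2 := le_ciSup h2 x
  have hy2 := le_ciSup h2 y
  have h := (le_abs_self _).trans (hφ (u x) (u y))
  rcases abs_cases (u x - u y) with ⟨h', -⟩ | ⟨h', -⟩ <;> rw [h'] at h <;> linarith

theorem bddAbove_range_of_abs {X : Type*} {F : X → ℝ} {B : ℝ} (h : ∀ x, |F x| ≤ B) :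
    BddAbove (Set.range F) :=
  ⟨B, by rintro _ ⟨x, rfl⟩; exact (abs_le.mp (h x)).2⟩

theorem abs_sum_boolSign_mul_le {X : Type*} {n : ℕ} (t : Fin n → X → ℝ) (B : Fin n → ℝ)
    (hB : ∀ i x, |t i x| ≤ B i) (ε : Fin n → Bool) (x : X) :
    |∑ i, boolSign (ε i) * t i x| ≤ ∑ i, B i := by
  refine (Finset.abs_sum_le_sum_abs _ _).trans (Finset.sum_le_sum fun i _ => ?_)
  rw [abs_mul, abs_boolSign, one_mul]
  exact hB i x

/-- The contraction principle for Rademacher averages. -/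
theorem rademacher_contraction {X : Type*} [Nonempty X] {n : ℕ} (t : Fin n → X → ℝ)
    (φ : Fin n → ℝ → ℝ) (hφ : ∀ i a b, |φ i a - φ i b| ≤ |a - b|) (hφ0 : ∀ i, φ i 0 = 0)
    (B : Fin n → ℝ) (hB : ∀ i x, |t i x| ≤ B i) (F : X → ℝ) (A : ℝ) (hF : ∀ x, |F x| ≤ A) :
    ∑ ε : Fin n → Bool, ⨆ x, (F x + ∑ i, boolSign (ε i) * φ i (t i x)) ≤
      ∑ ε : Fin n → Bool, ⨆ x, (F x + ∑ i, boolSign (ε i) * t i x) := by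
  induction n generalizing F A with
  | zero => simp
  | succ n ih =>
    rw [sum_bool_vector_succ, sum_bool_vector_succ]
    simp only [Fin.sum_univ_succ, Fin.cons_zero, Fin.cons_succ, boolSign_true,
      boolSign_false, one_mul, neg_one_mul, ← add_assoc]
    have hφB : ∀ x, |φ 0 (t 0 x)| ≤ B 0 := fun x => by
      have := hφ 0 (t 0 x) 0
      rw [hφ0, sub_zero, sub_zero] at this
      exact this.trans (hB 0 x)
    have ih1 := ih (fun i => t i.succ) (fun i => φ i.succ) (fun i => hφ i.succ)
      (fun i => hφ0 i.succ) (fun i => B i.succ) (fun i => hB i.succ) (fun x => F x + φ 0 (t 0 x))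
      (A + B 0) (fun x => (abs_add_le _ _).trans (add_le_add (hF x) (hφB x)))
    have ih2 := ih (fun i => t i.succ) (fun i => φ i.succ) (fun i => hφ i.succ)
      (fun i => hφ0 i.succ) (fun i => B i.succ) (fun i => hB i.succ) (fun x => F x + -φ 0 (t 0 x))
      (A + B 0) (fun x => (abs_add_le _ _).trans (add_le_add (hF x) (by rw [abs_neg]; exact hφB x)))
    rw [Finset.sum_add_distrib]
    refine (add_le_add ih1 ih2).trans ?_
    rw [← Finset.sum_add_distrib]
    refine Finset.sum_le_sum fun ε _ => ?_
    have hS := abs_sum_boolSign_mul_le (fun i => t i.succ) (fun i => B i.succ)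
      (fun i => hB i.succ) ε
    have hb : ∀ x, |F x + ∑ i, boolSign (ε i) * t i.succ x| ≤ A + ∑ i : Fin n, B i.succ :=
      fun x => (abs_add_le _ _).trans (add_le_add (hF x) (hS x))
    have := iSup_contraction (fun x => F x + ∑ i, boolSign (ε i) * t i.succ x) (t 0) (φ 0) (hφ 0)
      (bddAbove_range_of_abs fun x => (abs_add_le _ _).trans (add_le_add (hb x) (hB 0 x)))
      (bddAbove_range_of_abs fun x => (abs_sub _ _).trans (add_le_add (hb x) (hB 0 x)))
    simp only [add_right_comm (F _) _ (∑ i, _), ← sub_eq_add_neg, add_sub_right_comm] at this ⊢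
    exact this

/-- Summing out one sign at a time is the parallelogram law. The free vector `w` carries the terms
whose signs are already fixed. -/
theorem sum_norm_sq_rademacher {V : Type*} [NormedAddCommGroup V] [InnerProductSpace ℝ V] {n : ℕ}
    (v : Fin n → V) (w : V) :
    ∑ ε : Fin n → Bool, ‖w + ∑ i, boolSign (ε i) • v i‖ ^ 2 =
      2 ^ n * (‖w‖ ^ 2 + ∑ i, ‖v i‖ ^ 2) := by
  induction n generalizing w with
  | zero => simp
  | succ n ih =>
    rw [sum_bool_vector_succ]
    simp only [Fin.sum_univ_succ, Fin.cons_zero, Fin.cons_succ]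
    simp only [← add_assoc]
    rw [Finset.sum_add_distrib, ih, ih]
    have h := parallelogram_law_with_norm ℝ w (v 0)
    simp only [boolSign_true, boolSign_false, one_smul, neg_smul,
      ← sub_eq_add_neg]
    rw [pow_succ]
    linear_combination 2 ^ n * h

theorem sum_norm_rademacher_le {V : Type*} [NormedAddCommGroup V] [InnerProductSpace ℝ V] {n : ℕ}
    (v : Fin n → V) (hv : ∀ i, ‖v i‖ ≤ 1) :
    ∑ ε : Fin n → Bool, ‖∑ i, boolSign (ε i) • v i‖ ≤ 2 ^ n * Real.sqrt n := by
  have h1 := sum_norm_sq_rademacher v 0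
  simp only [zero_add, norm_zero, ne_eq, OfNat.ofNat_ne_zero, not_false_eq_true, zero_pow] at h1
  have h2 : ∑ i, ‖v i‖ ^ 2 ≤ n := by
    calc _ ≤ ∑ i : Fin n, (1 : ℝ) :=
          Finset.sum_le_sum fun i _ => pow_le_one₀ (norm_nonneg _) (hv i)
      _ = n := by simp
  have h3 := sq_sum_le_card_mul_sum_sq (s := Finset.univ)
    (f := fun ε : Fin n → Bool => ‖∑ i, boolSign (ε i) • v i‖)
  rw [h1] at h3
  simp only [Finset.card_univ, Fintype.card_fun, Fintype.card_bool, Fintype.card_fin,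
    Nat.cast_pow, Nat.cast_ofNat] at h3
  refine abs_le_of_sq_le_sq' ?_ (by positivity) |>.2
  rw [mul_pow, Real.sq_sqrt (Nat.cast_nonneg n)]
  refine h3.trans ?_
  rw [← mul_assoc, ← sq]
  gcongr

theorem abs_relu_sub_le (a b : ℝ) : |relu a - relu b| ≤ |a - b| := by
  unfold relu
  exact abs_max_sub_max_le_abs a b 0

theorem abs_relu_le (a : ℝ) : |relu a| ≤ |a| := by
  simpa [relu] using abs_relu_sub_le a 0

/-- A homogeneous ReLU neuron `z ↦ a σ⟪v, z⟫`. -/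
def neuron {V : Type*} [NormedAddCommGroup V] [InnerProductSpace ℝ V] (θ : ℝ × V) (z : V) : ℝ :=
  θ.1 * relu (inner ℝ θ.2 z)

theorem abs_neuron_le {V : Type*} [NormedAddCommGroup V] [InnerProductSpace ℝ V] (θ : ℝ × V)
    (z : V) : |neuron θ z| ≤ |θ.1| * (‖θ.2‖ * ‖z‖) := by
  rw [neuron, abs_mul]
  gcongr
  exact (abs_relu_le _).trans (abs_real_inner_le_norm _ _)

/-- Contraction strips the ReLU and the outer coefficient. What remains is the supremum of a linear
functional on a ball, that is `R` times a norm, so neither the dimension of `V` nor a covering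
number enters. -/
theorem rademacher_neuron_le {V : Type*} [NormedAddCommGroup V] [InnerProductSpace ℝ V] {n : ℕ}
    (θ : Fin n → ℝ × V) (ha : ∀ i, |(θ i).1| ≤ 1) (hv : ∀ i, ‖(θ i).2‖ ≤ 1) {R : ℝ} (hR : 0 ≤ R) :
    ∑ ε : Fin n → Bool,
      ⨆ z : Metric.closedBall (0 : V) R, (∑ i, boolSign (ε i) * neuron (θ i) z) ≤
      2 ^ n * (R * Real.sqrt n) := by
  have hne : Nonempty (Metric.closedBall (0 : V) R) := ⟨⟨0, by simpa using hR⟩⟩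
  have hz : ∀ z : Metric.closedBall (0 : V) R, ‖(z : V)‖ ≤ R := fun z =>
    mem_closedBall_zero_iff.mp z.2
  have h := rademacher_contraction (X := Metric.closedBall (0 : V) R)
    (fun i z => inner ℝ (θ i).2 (z : V)) (fun i a => (θ i).1 * relu a)
    (fun i a b => by
      rw [← mul_sub, abs_mul]
      calc _ ≤ 1 * |relu a - relu b| := by gcongr; exact ha i
        _ ≤ _ := by rw [one_mul]; exact abs_relu_sub_le a b)
    (fun i => by simp [relu]) (fun _ => R)
    (fun i z => (abs_real_inner_le_norm _ _).trans (by
      have := hz z; have := hv i; have := norm_nonneg (z : V)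
      nlinarith [norm_nonneg (θ i).2]))
    (fun _ => 0) 0 (fun _ => by simp)
  simp only [zero_add] at h
  refine h.trans ?_
  calc _ ≤ ∑ ε : Fin n → Bool, R * ‖∑ i, boolSign (ε i) • (θ i).2‖ := by
        refine Finset.sum_le_sum fun ε _ => ciSup_le fun z => ?_
        have : ∑ i, boolSign (ε i) * inner ℝ (θ i).2 (z : V) =
            inner ℝ (∑ i, boolSign (ε i) • (θ i).2) (z : V) := by
          simp [sum_inner, real_inner_smul_left]
        rw [this, mul_comm]
        refine (real_inner_le_norm _ _).trans ?_
        gcongr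
        exact hz z
    _ ≤ R * (2 ^ n * Real.sqrt n) := by
        rw [← Finset.mul_sum]
        gcongr
        exact sum_norm_rademacher_le _ hv
    _ = _ := by ring

/-- Signs which balance two families of neurons on a ball at the same time. -/
theorem exists_balancing_signs {V : Type*} [NormedAddCommGroup V] [InnerProductSpace ℝ V] {n : ℕ}
    (θ θ' : Fin n → ℝ × V) (ha : ∀ i, |(θ i).1| ≤ 1) (hv : ∀ i, ‖(θ i).2‖ ≤ 1)
    (ha' : ∀ i, |(θ' i).1| ≤ 1) (hv' : ∀ i, ‖(θ' i).2‖ ≤ 1) {R : ℝ} (hR : 0 ≤ R) :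
    ∃ ε : Fin n → Bool, ∀ z : V, ‖z‖ ≤ R →
      |∑ i, boolSign (ε i) * (neuron (θ i) z - neuron (θ' i) z)| ≤ 4 * R * Real.sqrt n := by
  have hne : Nonempty (Metric.closedBall (0 : V) R) := ⟨⟨0, by simpa using hR⟩⟩
  set S : (Fin n → ℝ × V) → (Fin n → Bool) → ℝ := fun η ε =>
    ⨆ z : Metric.closedBall (0 : V) R, (∑ i, boolSign (ε i) * neuron (η i) z) with hS
  have hbdd : ∀ η : Fin n → ℝ × V, ∀ ε : Fin n → Bool, BddAbove (Set.range
      fun z : Metric.closedBall (0 : V) R => ∑ i, boolSign (ε i) * neuron (η i) z) := by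
    intro η ε
    refine bddAbove_range_of_abs (B := ∑ i, |(η i).1| * (‖(η i).2‖ * R)) fun z =>
      abs_sum_boolSign_mul_le (fun i (z : Metric.closedBall (0 : V) R) => neuron (η i) z) _
        (fun i z => (abs_neuron_le _ _).trans ?_) ε z
    have : ‖(z : V)‖ ≤ R := mem_closedBall_zero_iff.mp z.2
    gcongr
  have hle : ∀ (η : Fin n → ℝ × V) (ε : Fin n → Bool), ∀ z : V, ‖z‖ ≤ R → ∑ i, boolSign (ε i) * neuron (η i) z ≤ S η ε :=
    fun η ε z hz => le_ciSup (hbdd η ε) ⟨z, by simpa using hz⟩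
  have hS0 : ∀ η ε, 0 ≤ S η ε := fun η ε => by
    have := hle η ε 0 (by simpa using hR)
    simpa [neuron, relu] using this
  let neg : (Fin n → ℝ × V) → Fin n → ℝ × V := fun η i => (-(η i).1, (η i).2)
  have hneg : ∀ (η : Fin n → ℝ × V) (ε : Fin n → Bool) (z : V), ∑ i, boolSign (ε i) * neuron (neg η i) z =
      -∑ i, boolSign (ε i) * neuron (η i) z := fun η ε z => by
    simp [neg, neuron]
  have e1 := rademacher_neuron_le θ ha hv hR
  have e2 := rademacher_neuron_le (neg θ) (fun i => by simpa [neg] using ha i) hv hR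
  have e3 := rademacher_neuron_le θ' ha' hv' hR
  have e4 := rademacher_neuron_le (neg θ') (fun i => by simpa [neg] using ha' i) hv' hR
  -- Four one-sided suprema are averaged together: both families, each also with outer coefficients
  -- negated. Each is nonnegative because neurons vanish at `z = 0`, so a bound on the total
  -- controls all of them for one choice of signs.
  obtain ⟨ε, -, hε⟩ := Finset.exists_le_of_sum_le (s := Finset.univ)
    (f := fun ε : Fin n → Bool => S θ ε + S (neg θ) ε + (S θ' ε + S (neg θ') ε))
    (g := fun _ => 4 * R * Real.sqrt n) Finset.univ_nonempty (by
      simp only [Finset.sum_add_distrib, Finset.sum_const, Finset.card_univ, Fintype.card_fun,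
        Fintype.card_bool, Fintype.card_fin, nsmul_eq_mul, Nat.cast_pow, Nat.cast_ofNat]
      linarith)
  refine ⟨ε, fun z hz => ?_⟩
  have g1 := hle θ ε z hz
  have g2 := hle (neg θ) ε z hz
  have g3 := hle θ' ε z hz
  have g4 := hle (neg θ') ε z hz
  rw [hneg] at g2 g4
  have p1 := hS0 θ ε
  have p2 := hS0 (neg θ) ε
  have p3 := hS0 θ' ε
  have p4 := hS0 (neg θ') ε
  simp only [mul_sub, Finset.sum_sub_distrib]
  rw [abs_le]
  constructor <;> linarith
/-! ### Uniform approximation by few neurons -/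

section Maurey

variable {V : Type*} [NormedAddCommGroup V] [InnerProductSpace ℝ V]

/-- Parameters of normalized neurons. -/
def unitParams (V : Type*) [NormedAddCommGroup V] : Set (ℝ × V) := {θ | |θ.1| ≤ 1 ∧ ‖θ.2‖ ≤ 1}

theorem abs_neuron_le_of_mem {θ : ℝ × V} (hθ : θ ∈ unitParams V) {R : ℝ} {z : V} (hz : ‖z‖ ≤ R) :
    |neuron θ z| ≤ R := by
  have h1 := hθ.1
  have h2 := hθ.2
  have h3 := norm_nonneg z
  calc _ ≤ |θ.1| * (‖θ.2‖ * ‖z‖) := abs_neuron_le θ z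
    _ ≤ 1 * (1 * R) := by gcongr
    _ = R := by ring

theorem exists_half_of_pairs {n : ℕ} (θ θ' : Fin n → ℝ × V) (hθ : ∀ i, θ i ∈ unitParams V)
    (hθ' : ∀ i, θ' i ∈ unitParams V) {R : ℝ} (hR : 0 ≤ R) :
    ∃ η : Fin n → ℝ × V, (∀ i, η i ∈ unitParams V) ∧ ∀ z : V, ‖z‖ ≤ R →
      |∑ i, neuron (θ i) z + ∑ i, neuron (θ' i) z - 2 * ∑ i, neuron (η i) z| ≤
        4 * R * Real.sqrt n := by
  obtain ⟨ε, hε⟩ := exists_balancing_signs θ θ' (fun i => (hθ i).1) (fun i => (hθ i).2)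
    (fun i => (hθ' i).1) (fun i => (hθ' i).2) hR
  -- Keeping one neuron of each pair with doubled weight errs by exactly the signed sum of the
  -- differences.
  refine ⟨fun i => if ε i then θ i else θ' i, fun i => ?_, fun z hz => ?_⟩
  · cases h : ε i <;> simp [h, hθ i, hθ' i]
  · have h : ∑ i, neuron (θ i) z + ∑ i, neuron (θ' i) z -
        2 * ∑ i, neuron (if ε i then θ i else θ' i) z =
        -∑ i, boolSign (ε i) * (neuron (θ i) z - neuron (θ' i) z) := by
      rw [Finset.mul_sum, ← Finset.sum_add_distrib, ← Finset.sum_sub_distrib,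
        ← Finset.sum_neg_distrib]
      refine Finset.sum_congr rfl fun i _ => ?_
      cases ε i <;> simp <;> ring
    rw [h, abs_neg]
    exact hε z hz

/-- Since `4 / 3 ≤ √2`, the errors of successive halvings are dominated by a geometric series with a
rational ratio. -/
theorem inv_sqrt_mul_two_pow_le (m k : ℕ) (hm : 1 ≤ m) :
    1 / Real.sqrt ((m * 2 ^ k : ℕ) : ℝ) ≤ (3 / 4) ^ k / Real.sqrt m := by
  have hm0 : (0 : ℝ) < m := by exact_mod_cast hm
  have h : ((4 : ℝ) / 3) ^ k ≤ Real.sqrt (2 ^ k) := by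
    apply Real.le_sqrt_of_sq_le
    rw [← pow_mul, mul_comm k 2, pow_mul]
    gcongr
    norm_num
  push_cast
  rw [Real.sqrt_mul hm0.le, one_div, mul_inv, mul_comm, div_eq_mul_inv]
  gcongr
  rw [inv_le_comm₀ (by positivity) (by positivity), ← inv_pow]
  norm_num [h]

/-- Repeated halving of a uniform average of `m 2^k` normalized neurons. -/
theorem exists_subaverage {m : ℕ} (hm : 1 ≤ m) {R : ℝ} (hR : 0 ≤ R) (k : ℕ) {N : ℕ}
    (hN : N = m * 2 ^ k) (θ : Fin N → ℝ × V) (hθ : ∀ i, θ i ∈ unitParams V) :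
    ∃ η : Fin m → ℝ × V, (∀ i, η i ∈ unitParams V) ∧ ∀ z : V, ‖z‖ ≤ R →
      |(∑ i, neuron (θ i) z) / N - (∑ i, neuron (η i) z) / m| ≤
        2 * R / Real.sqrt m * ∑ j ∈ Finset.range k, (3 / 4 : ℝ) ^ j := by
  induction k generalizing N with
  | zero =>
    obtain rfl : N = m := by simpa using hN
    exact ⟨θ, hθ, fun z _ => by simp⟩
  | succ k ih =>
    set n := m * 2 ^ k with hn
    obtain rfl : N = n + n := by rw [hN, hn]; ring
    have hn1 : 1 ≤ n := Nat.mul_pos hm (by positivity)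
    have hn0 : (0 : ℝ) < n := by exact_mod_cast hn1
    obtain ⟨θ₁, h1, h2⟩ := exists_half_of_pairs (fun i => θ (Fin.castAdd n i))
      (fun i => θ (Fin.natAdd n i)) (fun i => hθ _) (fun i => hθ _) hR
    obtain ⟨η, h3, h4⟩ := ih rfl θ₁ h1
    refine ⟨η, h3, fun z hz => ?_⟩
    have h5 := h2 z hz
    rw [← Fin.sum_univ_add (fun i => neuron (θ i) z)] at h5
    have h6 : |(∑ i, neuron (θ i) z) / ((n + n : ℕ) : ℝ) - (∑ i, neuron (θ₁ i) z) / n| ≤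
        2 * R / Real.sqrt m * (3 / 4) ^ k := by
      have e : (∑ i, neuron (θ i) z) / ((n + n : ℕ) : ℝ) - (∑ i, neuron (θ₁ i) z) / n =
          (∑ i, neuron (θ i) z - 2 * ∑ i, neuron (θ₁ i) z) / (2 * n) := by
        push_cast; field_simp; ring
      rw [e, abs_div, abs_of_pos (by positivity : (0 : ℝ) < 2 * n)]
      calc _ ≤ 4 * R * Real.sqrt n / (2 * n) := by gcongr
        _ = 2 * R * (1 / Real.sqrt n) := by
            have hs : Real.sqrt n ≠ 0 := (Real.sqrt_pos.mpr hn0).ne'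
            have hs2 : Real.sqrt n * Real.sqrt n = n := Real.mul_self_sqrt hn0.le
            calc _ = 4 * R * Real.sqrt n / (2 * (Real.sqrt n * Real.sqrt n)) := by rw [hs2]
              _ = _ := by field_simp; ring
        _ ≤ 2 * R * ((3 / 4) ^ k / Real.sqrt m) := by
            exact mul_le_mul_of_nonneg_left (inv_sqrt_mul_two_pow_le m k hm) (by positivity)
        _ = _ := by ring
    rw [Finset.sum_range_succ, mul_add]
    have := abs_add_le ((∑ i, neuron (θ i) z) / ((n + n : ℕ) : ℝ) - (∑ i, neuron (θ₁ i) z) / n)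
      ((∑ i, neuron (θ₁ i) z) / n - (∑ i, neuron (η i) z) / m)
    rw [sub_add_sub_cancel] at this
    linarith [h4 z hz]

/-- A convex combination of normalized neurons is nearly a uniform average of `m 2^k` of them. -/
theorem exists_uniform_average {ι : Type*} [Fintype ι] (w : ι → ℝ) (hw : ∀ i, 0 ≤ w i)
    (hw1 : ∑ i, w i = 1) (θ : ι → ℝ × V) (hθ : ∀ i, θ i ∈ unitParams V) {m : ℕ} (hm : 1 ≤ m)
    {R : ℝ} {ε : ℝ} (hε : 0 < ε) :
    ∃ (k : ℕ) (η : Fin (m * 2 ^ k) → ℝ × V), (∀ i, η i ∈ unitParams V) ∧ ∀ z : V, ‖z‖ ≤ R →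
      |∑ i, w i * neuron (θ i) z - (∑ i, neuron (η i) z) / ((m * 2 ^ k : ℕ) : ℝ)| ≤ ε := by
  -- Rounding each weight down to a multiple of `1 / N` costs at most `R / N` per term. The slots
  -- left over hold the zero neuron.
  obtain ⟨k, hk⟩ := pow_unbounded_of_one_lt (Fintype.card ι * R / ε) (one_lt_two (α := ℝ))
  set N := m * 2 ^ k with hN
  have hN1 : 1 ≤ N := Nat.mul_pos hm (by positivity)
  have hN0 : (0 : ℝ) < N := by exact_mod_cast hN1
  have hNk : Fintype.card ι * R / ε ≤ N := by
    refine hk.le.trans ?_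
    rw [hN]; push_cast
    exact le_mul_of_one_le_left (by positivity) (by exact_mod_cast hm)
  set c : ι → ℕ := fun i => ⌊N * w i⌋₊ with hc
  have hcle : ∀ i, (c i : ℝ) ≤ N * w i := fun i => Nat.floor_le (mul_nonneg hN0.le (hw i))
  have hclt : ∀ i, N * w i < c i + 1 := fun i => Nat.lt_floor_add_one _
  have hcN : ∑ i, c i ≤ N := by
    have : ((∑ i, c i : ℕ) : ℝ) ≤ N := by
      push_cast
      calc _ ≤ ∑ i, N * w i := Finset.sum_le_sum fun i _ => hcle i
        _ = N := by rw [← Finset.mul_sum, hw1, mul_one]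
    exact_mod_cast this
  have hcard : Fintype.card (Σ i, Fin (c i)) ≤ Fintype.card (Fin N) := by simpa using hcN
  obtain ⟨f⟩ := Function.Embedding.nonempty_of_card_le hcard
  refine ⟨k, fun h => (Function.partialInv f h).elim 0 fun σ => θ σ.1, fun h => ?_, fun z hz => ?_⟩
  · rcases ho : Function.partialInv f h with _ | σ
    · simp [ho, unitParams]
    · simp only [ho, Option.elim_some]; exact hθ _
  · rw [sum_partialInv f (fun o => neuron (o.elim 0 fun σ => θ σ.1) z) (by simp [neuron]),
      Fintype.sum_sigma]
    simp only [Option.elim_some, Finset.sum_const, Finset.card_univ, Fintype.card_fin,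
      nsmul_eq_mul]
    rw [Finset.sum_div, ← Finset.sum_sub_distrib]
    calc _ ≤ ∑ i, |w i * neuron (θ i) z - c i * neuron (θ i) z / N| :=
          Finset.abs_sum_le_sum_abs _ _
      _ ≤ ∑ i : ι, 1 / N * R := by
          refine Finset.sum_le_sum fun i _ => ?_
          rw [show w i * neuron (θ i) z - c i * neuron (θ i) z / N =
            (N * w i - c i) / N * neuron (θ i) z by field_simp, abs_mul]
          gcongr
          · rw [abs_of_nonneg (div_nonneg (by linarith [hcle i]) hN0.le)]
            gcongr
            linarith [hclt i]
          · exact abs_neuron_le_of_mem (hθ i) hz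
      _ ≤ ε := by
          rw [Finset.sum_const, Finset.card_univ, nsmul_eq_mul]
          rw [div_le_iff₀ hε] at hNk
          rw [one_div_mul_eq_div, mul_div_assoc', div_le_iff₀ hN0]
          linarith

/-- The constant `9` is `8` from the halvings, where the geometric series sums to at most `4`, plus
`1` for discretizing the weights. -/
theorem exists_neurons_of_convex {ι : Type*} [Fintype ι] (w : ι → ℝ) (hw : ∀ i, 0 ≤ w i)
    (hw1 : ∑ i, w i = 1) (θ : ι → ℝ × V) (hθ : ∀ i, θ i ∈ unitParams V) {m : ℕ} (hm : 1 ≤ m)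
    {R : ℝ} (hR : 0 < R) :
    ∃ η : Fin m → ℝ × V, ∀ z : V, ‖z‖ ≤ R →
      |∑ i, w i * neuron (θ i) z - ∑ i, neuron (η i) z| ≤ 9 * R / Real.sqrt m := by
  have hm0 : (0 : ℝ) < m := by exact_mod_cast hm
  have hs := Real.sqrt_pos.mpr hm0
  obtain ⟨k, η₁, h1, h2⟩ := exists_uniform_average w hw hw1 θ hθ hm
    (show 0 < R / Real.sqrt m by positivity)
  obtain ⟨η, h3, h4⟩ := exists_subaverage hm hR.le k rfl η₁ h1
  refine ⟨fun i => ((η i).1 / m, (η i).2), fun z hz => ?_⟩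
  have e : ∑ i, neuron ((η i).1 / m, (η i).2) z = (∑ i, neuron (η i) z) / m := by
    rw [Finset.sum_div]
    exact Finset.sum_congr rfl fun i _ => by simp only [neuron]; ring
  rw [e]
  have h5 := h2 z hz
  have h6 := h4 z hz
  have h7 : ∑ j ∈ Finset.range k, (3 / 4 : ℝ) ^ j ≤ 4 := by
    refine ((summable_geometric_of_lt_one (r := (3 / 4 : ℝ)) (by norm_num)
      (by norm_num)).sum_le_tsum _ fun _ _ => by positivity).trans ?_
    rw [tsum_geometric_of_lt_one (by norm_num) (by norm_num)]
    norm_num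
  have h8 : 2 * R / Real.sqrt m * ∑ j ∈ Finset.range k, (3 / 4 : ℝ) ^ j ≤
      8 * (R / Real.sqrt m) := by
    calc _ ≤ 2 * R / Real.sqrt m * 4 := by gcongr
      _ = _ := by ring
  have := abs_add_le (∑ i, w i * neuron (θ i) z -
    (∑ i, neuron (η₁ i) z) / ((m * 2 ^ k : ℕ) : ℝ))
    ((∑ i, neuron (η₁ i) z) / ((m * 2 ^ k : ℕ) : ℝ) - (∑ i, neuron (η i) z) / m)
  rw [sub_add_sub_cancel] at this
  have e9 : 9 * R / Real.sqrt m = 9 * (R / Real.sqrt m) := by ring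
  linarith

theorem relu_mul_of_nonneg {c : ℝ} (hc : 0 ≤ c) (t : ℝ) : relu (c * t) = c * relu t := by
  simp [relu, mul_max_of_nonneg _ _ hc]

/-- ReLU is positively homogeneous, so the size of a neuron factors out and only the sign of the
outer coefficient stays inside. -/
theorem exists_unitParams_smul (θ : ℝ × V) : ∃ η ∈ unitParams V, ∀ z : V,
    neuron θ z = |θ.1| * ‖θ.2‖ * neuron η z := by
  refine ⟨(SignType.sign θ.1, ‖θ.2‖⁻¹ • θ.2), ⟨?_, ?_⟩, fun z => ?_⟩
  · rcases lt_trichotomy θ.1 0 with h | h | h <;> simp [h]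
  · rw [norm_smul, norm_inv, norm_norm]
    exact inv_mul_le_one
  · simp only [neuron, real_inner_smul_left]
    rw [relu_mul_of_nonneg (by positivity)]
    by_cases h : θ.2 = 0
    · simp [h, relu]
    · have hn : ‖θ.2‖ ≠ 0 := norm_ne_zero_iff.mpr h
      have := sign_mul_abs θ.1
      field_simp
      linear_combination -relu (inner ℝ θ.2 z) * this

/-- Neurons as continuous functions on a ball, depending continuously on the parameters. -/
def neuronMap (V : Type*) [NormedAddCommGroup V] [InnerProductSpace ℝ V] (R : ℝ) :
    C(ℝ × V, C(Metric.closedBall (0 : V) R, ℝ)) :=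
  ContinuousMap.curry ⟨fun p => neuron p.1 p.2, by
    unfold neuron relu
    fun_prop⟩

theorem neuronMap_apply (R : ℝ) (θ : ℝ × V) (z : Metric.closedBall (0 : V) R) :
    neuronMap V R θ z = neuron θ z := rfl

variable [FiniteDimensional ℝ V] [MeasurableSpace V] [BorelSpace V]

/-- Dimension-free uniform approximation of an integral of neurons by `m` neurons. -/
theorem exists_neurons_of_integral {Ω : Type*} [MeasurableSpace Ω] (ρ : MeasureTheory.Measure Ω)
    (θ : Ω → ℝ × V) (hθ : Measurable θ) {A : ℝ} (hA : 0 < A)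
    (hint : MeasureTheory.Integrable (fun ω => |(θ ω).1| * ‖(θ ω).2‖) ρ)
    (hle : ∫ ω, |(θ ω).1| * ‖(θ ω).2‖ ∂ρ ≤ A) {R : ℝ} (hR : 0 < R) {m : ℕ} (hm : 1 ≤ m) :
    ∃ η : Fin m → ℝ × V, ∀ z : V, ‖z‖ ≤ R →
      |∫ ω, neuron (θ ω) z ∂ρ - ∑ i, neuron (η i) z| ≤ 10 * A * R / Real.sqrt m := by
  have hproper : ProperSpace V := FiniteDimensional.proper_real V
  have hsec : SecondCountableTopology V := inferInstance
  have hcomp : CompactSpace (Metric.closedBall (0 : V) R) :=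
    isCompact_iff_compactSpace.mp (isCompact_closedBall 0 R)
  have hm0 : (0 : ℝ) < m := by exact_mod_cast hm
  have hs := Real.sqrt_pos.mpr hm0
  set G : Ω → C(Metric.closedBall (0 : V) R, ℝ) := fun ω => neuronMap V R (θ ω) with hG
  have hGm : MeasureTheory.AEStronglyMeasurable G ρ :=
    (neuronMap V R).continuous.comp_aestronglyMeasurable hθ.aestronglyMeasurable
  have hGn : ∀ ω, ‖G ω‖ ≤ |(θ ω).1| * ‖(θ ω).2‖ * R := fun ω => by
    refine (ContinuousMap.norm_le _ (by positivity)).mpr fun z => ?_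
    have hz : ‖(z : V)‖ ≤ R := mem_closedBall_zero_iff.mp z.2
    rw [Real.norm_eq_abs, neuronMap_apply, mul_assoc]
    refine (abs_neuron_le _ _).trans ?_
    gcongr
  have hGi : MeasureTheory.Integrable G ρ :=
    (hint.mul_const R).mono' hGm (Filter.Eventually.of_forall hGn)
  set E : Set C(Metric.closedBall (0 : V) R, ℝ) :=
    (fun η => A • neuronMap V R η) '' unitParams V with hE
  -- A separating functional `f` satisfies `f (G ω) ≤ weight * (u / A)` pointwise. As the weights
  -- integrate to at most `A`, integration contradicts strict separation. Positivity of `u` comes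
  -- from the zero neuron in `E`.
  have hmem : ∫ ω, G ω ∂ρ ∈ closure (convexHull ℝ E) := by
    by_contra hnot
    obtain ⟨f, u, hf, hu⟩ := geometric_hahn_banach_closed_point
      (convex_convexHull ℝ E).closure isClosed_closure hnot
    have hfE : ∀ η ∈ unitParams V, A * f (neuronMap V R η) < u := fun η hη => by
      have := hf _ (subset_closure (subset_convexHull ℝ E ⟨η, hη, rfl⟩))
      simpa using this
    have hu0 : 0 < u := by
      have := hfE 0 (by simp [unitParams])
      have h0 : neuronMap V R 0 = 0 := by ext z; simp [neuronMap_apply, neuron]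
      simpa [h0] using this
    rw [← f.integral_comp_comm hGi] at hu
    have hpt : ∀ ω, f (G ω) ≤ |(θ ω).1| * ‖(θ ω).2‖ * (u / A) := fun ω => by
      obtain ⟨η, hη, h⟩ := exists_unitParams_smul (θ ω)
      have e : G ω = (|(θ ω).1| * ‖(θ ω).2‖) • neuronMap V R η := by
        ext z; simpa [hG, neuronMap_apply] using h z
      rw [e, map_smul, smul_eq_mul]
      gcongr
      rw [le_div_iff₀ hA, mul_comm]
      exact (hfE η hη).le
    have := MeasureTheory.integral_mono (f.integrable_comp hGi) (hint.mul_const (u / A)) hpt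
    rw [MeasureTheory.integral_mul_const] at this
    have h2 : (∫ ω, |(θ ω).1| * ‖(θ ω).2‖ ∂ρ) * (u / A) ≤ A * (u / A) := by gcongr
    rw [mul_div_cancel₀ _ hA.ne'] at h2
    linarith
  obtain ⟨y, hy, hdist⟩ := Metric.mem_closure_iff.mp hmem (A * R / Real.sqrt m) (by positivity)
  rw [mem_convexHull_iff_exists_fintype] at hy
  obtain ⟨ι, _, w, x, hw, hw1, hx, rfl⟩ := hy
  choose η₀ hη₀ hη₀x using hx
  obtain ⟨η, hη⟩ := exists_neurons_of_convex w hw hw1 η₀ hη₀ hm hR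
  refine ⟨fun i => (A * (η i).1, (η i).2), fun z hz => ?_⟩
  set z' : Metric.closedBall (0 : V) R := ⟨z, mem_closedBall_zero_iff.mpr hz⟩ with hz'
  have e1 : ∫ ω, neuron (θ ω) z ∂ρ = (∫ ω, G ω ∂ρ) z' := by
    have := (ContinuousMap.evalCLM ℝ z').integral_comp_comm hGi
    simpa [hG, neuronMap_apply] using this
  have e2 : (∑ i, w i • x i) z' = A * ∑ i, w i * neuron (η₀ i) z := by
    simp only [ContinuousMap.coe_sum, Finset.sum_apply, ContinuousMap.coe_smul, Pi.smul_apply,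
      smul_eq_mul, ← hη₀x, neuronMap_apply, Finset.mul_sum]
    exact Finset.sum_congr rfl fun i _ => by ring
  have e3 : ∑ i, neuron (A * (η i).1, (η i).2) z = A * ∑ i, neuron (η i) z := by
    rw [Finset.mul_sum]
    exact Finset.sum_congr rfl fun i _ => by simp only [neuron]; ring
  have h1 : |(∫ ω, G ω ∂ρ) z' - (∑ i, w i • x i) z'| ≤ A * R / Real.sqrt m := by
    refine le_trans ?_ hdist.le
    rw [← Real.dist_eq]
    exact ContinuousMap.dist_apply_le_dist z'
  have h2 : |A * ∑ i, w i * neuron (η₀ i) z - A * ∑ i, neuron (η i) z| ≤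
      A * (9 * R / Real.sqrt m) := by
    rw [← mul_sub, abs_mul, abs_of_pos hA]
    gcongr
    exact hη z hz
  rw [e1, e3]
  rw [e2] at h1
  have h3 := abs_add_le ((∫ ω, G ω ∂ρ) z' - A * ∑ i, w i * neuron (η₀ i) z)
    (A * ∑ i, w i * neuron (η₀ i) z - A * ∑ i, neuron (η i) z)
  rw [sub_add_sub_cancel] at h3
  have e4 : 10 * A * R / Real.sqrt m = A * R / Real.sqrt m + A * (9 * R / Real.sqrt m) := by ring
  linarith

end Maurey

/-! ### Barron functions -/

section Barron

variable {ι : Type*} [Fintype ι]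

/-- The homogeneous parameter `(a, (c, b))` of the neuron `x ↦ a σ(bᵀx + c)`. -/
def homogenize (ω : ℝ × (ι → ℝ) × ℝ) : ℝ × EuclideanSpace ℝ (Option ι) :=
  (ω.1, WithLp.toLp 2 fun o => o.elim ω.2.2 ω.2.1)

/-- The affine embedding `x ↦ (1, x)`. -/
def homogenizePoint (x : EuclideanSpace ℝ ι) : EuclideanSpace ℝ (Option ι) :=
  WithLp.toLp 2 fun o => o.elim 1 x

theorem measurable_homogenize : Measurable (homogenize (ι := ι)) := by
  refine Continuous.measurable ?_
  refine continuous_fst.prodMk ((PiLp.continuous_toLp 2 _).comp (continuous_pi fun o => ?_))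
  cases o with
  | none => exact continuous_snd.comp continuous_snd
  | some i => exact (continuous_apply i).comp (continuous_fst.comp continuous_snd)

theorem inner_homogenizePoint (v : EuclideanSpace ℝ (Option ι)) (x : EuclideanSpace ℝ ι) :
    inner ℝ v (homogenizePoint x) = ∑ i, v (some i) * x i + v none := by
  simp [homogenizePoint, PiLp.inner_apply, Fintype.sum_option, mul_comm, add_comm]

theorem neuron_homogenize (ω : ℝ × (ι → ℝ) × ℝ) (x : EuclideanSpace ℝ ι) :
    neuron (homogenize ω) (homogenizePoint x) = ω.1 * relu (∑ i, ω.2.1 i * x i + ω.2.2) := by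
  rw [neuron, inner_homogenizePoint]
  rfl

theorem norm_homogenize_le (ω : ℝ × (ι → ℝ) × ℝ) :
    ‖(homogenize ω).2‖ ≤ ∑ i, |ω.2.1 i| + |ω.2.2| := by
  have h0 : 0 ≤ ∑ i, |ω.2.1 i| + |ω.2.2| := by positivity
  rw [EuclideanSpace.norm_eq]
  refine Real.sqrt_le_iff.mpr ⟨h0, ?_⟩
  refine (Finset.sum_sq_le_sq_sum_of_nonneg fun _ _ => norm_nonneg _).trans (le_of_eq ?_)
  rw [Fintype.sum_option, add_comm]
  rfl

theorem norm_homogenizePoint_le {x : EuclideanSpace ℝ ι} {R : ℝ} (hR : 1 ≤ R) (hx : ‖x‖ ≤ R) :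
    ‖homogenizePoint x‖ ≤ 2 * R := by
  rw [EuclideanSpace.norm_eq, Fintype.sum_option]
  refine Real.sqrt_le_iff.mpr ⟨by linarith, ?_⟩
  have h : ∑ i, ‖x i‖ ^ 2 = ‖x‖ ^ 2 := (EuclideanSpace.norm_sq_eq x).symm
  have h1 : ‖homogenizePoint x none‖ = 1 := by simp [homogenizePoint]
  have h2 : ∑ i, ‖homogenizePoint x (some i)‖ ^ 2 = ‖x‖ ^ 2 := h
  rw [h1, h2]
  nlinarith [norm_nonneg x]

/-- A representing measure whose first moment is close to the Barron norm. -/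
theorem exists_barron_representation {S : Set (EuclideanSpace ℝ ι)} {f : EuclideanSpace ℝ ι → ℝ}
    {A : ℝ} (hA : barronNorm S f < ENNReal.ofReal A) :
    ∃ ρ : MeasureTheory.Measure (ℝ × (ι → ℝ) × ℝ), MeasureTheory.IsProbabilityMeasure ρ ∧
      (∀ x ∈ S, f x = ∫ ω, neuron (homogenize ω) (homogenizePoint x) ∂ρ) ∧
      MeasureTheory.Integrable (fun ω => |(homogenize ω).1| * ‖(homogenize ω).2‖) ρ ∧
      ∫ ω, |(homogenize ω).1| * ‖(homogenize ω).2‖ ∂ρ ≤ A := by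
  simp only [barronNorm, iInf_lt_iff] at hA
  obtain ⟨ρ, hρ, hrep, hlt⟩ := hA
  have hApos : 0 < A := ENNReal.ofReal_pos.mp (bot_lt_iff_ne_bot.mpr fun h => by simp [h] at hlt)
  set W : ℝ × (ι → ℝ) × ℝ → ℝ := fun ω => |ω.1| * (∑ i, |ω.2.1 i| + |ω.2.2|) with hW
  have hW0 : ∀ ω, 0 ≤ W ω := fun ω => by positivity
  have hWm : Measurable W := by fun_prop
  have hWint : MeasureTheory.Integrable W ρ :=
    (MeasureTheory.lintegral_ofReal_ne_top_iff_integrable hWm.aestronglyMeasurable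
      (Filter.Eventually.of_forall hW0)).mp (hlt.trans ENNReal.ofReal_lt_top).ne
  have hle : ∀ ω, |(homogenize ω).1| * ‖(homogenize ω).2‖ ≤ W ω := fun ω =>
    mul_le_mul_of_nonneg_left (norm_homogenize_le ω) (abs_nonneg _)
  have hm : Measurable fun ω : ℝ × (ι → ℝ) × ℝ => |(homogenize ω).1| * ‖(homogenize ω).2‖ :=
    (measurable_fst.comp measurable_homogenize).abs.mul
      (measurable_snd.comp measurable_homogenize).norm
  have hint : MeasureTheory.Integrable
      (fun ω => |(homogenize ω).1| * ‖(homogenize ω).2‖) ρ :=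
    hWint.mono' hm.aestronglyMeasurable (Filter.Eventually.of_forall fun ω => by
      rw [Real.norm_of_nonneg (by positivity)]; exact hle ω)
  refine ⟨ρ, hρ, fun x hx => ?_, hint, ?_⟩
  · simp_rw [neuron_homogenize]
    exact hrep x hx
  · refine (MeasureTheory.integral_mono hint hWint hle).trans ?_
    rw [MeasureTheory.integral_eq_lintegral_of_nonneg_ae (Filter.Eventually.of_forall hW0)
      hWm.aestronglyMeasurable]
    exact ENNReal.toReal_le_of_le_ofReal hApos.le hlt.le

/-- Besides settling the case of norm zero, this bounds Barron norms from below at a point where `f`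
is not small, which later absorbs additive constants in neuron counts. -/
theorem abs_le_barronNorm {S : Set (EuclideanSpace ℝ ι)} {f : EuclideanSpace ℝ ι → ℝ}
    (hf : barronNorm S f ≠ ∞) {R : ℝ} (hR : 1 ≤ R) {x : EuclideanSpace ℝ ι} (hxS : x ∈ S)
    (hx : ‖x‖ ≤ R) : |f x| ≤ 2 * R * (barronNorm S f).toReal := by
  have key : ∀ A, (barronNorm S f).toReal < A → |f x| ≤ 2 * R * A := fun A hA => by
    obtain ⟨ρ, hρ, hrep, hint, hle⟩ := exists_barron_representation
      ((ENNReal.lt_ofReal_iff_toReal_lt hf).mpr hA)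
    rw [hrep x hxS]
    calc _ ≤ ∫ ω, |(homogenize ω).1| * ‖(homogenize ω).2‖ * (2 * R) ∂ρ := by
          rw [← Real.norm_eq_abs]
          refine MeasureTheory.norm_integral_le_of_norm_le (hint.mul_const _)
            (Filter.Eventually.of_forall fun ω => ?_)
          rw [Real.norm_eq_abs, mul_assoc]
          refine (abs_neuron_le _ _).trans ?_
          gcongr
          exact norm_homogenizePoint_le hR hx
      _ ≤ A * (2 * R) := by
          rw [MeasureTheory.integral_mul_const]
          gcongr
      _ = 2 * R * A := by ring
  refine le_of_forall_pos_le_add fun δ hδ => ?_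
  have := key ((barronNorm S f).toReal + δ / (2 * R)) (by
    have : 0 < δ / (2 * R) := by positivity
    linarith)
  rw [mul_add, mul_div_cancel₀ _ (by positivity)] at this
  exact this

/-- Barron functions on bounded sets are uniformly approximated by networks with `m` neurons. -/
theorem exists_network_of_barron {S : Set (EuclideanSpace ℝ ι)} {f : EuclideanSpace ℝ ι → ℝ}
    (hf : barronNorm S f ≠ ∞) {R : ℝ} (hR : 1 ≤ R) (hS : ∀ x ∈ S, ‖x‖ ≤ R) {m : ℕ} (hm : 1 ≤ m) :
    ∃ (a : Fin m → ℝ) (b : Fin m → ι → ℝ) (c : Fin m → ℝ), ∀ x ∈ S,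
      |f x - ∑ k, a k * relu (∑ i, b k i * x i + c k)| ≤
        40 * (barronNorm S f).toReal * R / Real.sqrt m := by
  rcases (ENNReal.toReal_nonneg (a := barronNorm S f)).eq_or_lt with h0 | hpos
  · refine ⟨0, 0, 0, fun x hx => ?_⟩
    have := abs_le_barronNorm hf hR hx (hS x hx)
    rw [← h0, mul_zero] at this
    simpa [← h0] using this
  -- The infimum need not be attained, so twice the norm is allowed. With the radius `2 * R` of the
  -- homogenized points, the constant is `10 * 2 * 2 = 40`.
  · obtain ⟨ρ, hρ, hrep, hint, hle⟩ := exists_barron_representation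
      ((ENNReal.lt_ofReal_iff_toReal_lt hf).mpr
        (show (barronNorm S f).toReal < 2 * (barronNorm S f).toReal by linarith))
    obtain ⟨η, hη⟩ := exists_neurons_of_integral ρ homogenize measurable_homogenize
      (by linarith) hint hle (show 0 < 2 * R by linarith) hm
    refine ⟨fun k => (η k).1, fun k i => (η k).2 (some i), fun k => (η k).2 none,
      fun x hx => ?_⟩
    have := hη _ (norm_homogenizePoint_le hR (hS x hx))
    rw [← hrep x hx] at this
    simp only [neuron, inner_homogenizePoint] at this
    refine this.trans (le_of_eq ?_)
    ring

end Barron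

/-! ### Recovering the memories after the first feed-forward layer -/

theorem round_eq_of_abs_sub_lt {x : ℝ} {n : ℤ} (h : |x - n| < 1 / 2) : round x = n := by
  rw [round_eq_iff]
  obtain ⟨h1, h2⟩ := abs_lt.mp h
  exact ⟨by linarith, by linarith⟩

theorem exists_network_error_le {d : ℕ} {S : Set (Token d)} (hS : ∀ x ∈ S, ‖x‖ ≤ 1)
    {f : Token d → ℝ} (hf : barronNorm S f ≠ ∞) {δ : ℝ} (hδ : 0 < δ) :
    ∃ (q : ℕ) (a : Fin q → ℝ) (b : Fin q → Fin d → ℝ) (c : Fin q → ℝ),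
      (q : ℝ) ≤ 1600 * (barronNorm S f).toReal ^ 2 / δ ^ 2 + 2 ∧ ∀ x ∈ S,
        |f x - ∑ k, a k * relu (∑ i, b k i * x i + c k)| ≤ δ := by
  set β := (barronNorm S f).toReal with hβ
  have hβ0 : 0 ≤ β := ENNReal.toReal_nonneg
  set q : ℕ := ⌈1600 * β ^ 2 / δ ^ 2⌉₊ + 1 with hq
  have hceil := Nat.le_ceil (1600 * β ^ 2 / δ ^ 2)
  have hceil' := Nat.ceil_lt_add_one (show 0 ≤ 1600 * β ^ 2 / δ ^ 2 by positivity)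
  obtain ⟨a, b, c, habc⟩ := exists_network_of_barron hf le_rfl hS (show 1 ≤ q by omega)
  refine ⟨q, a, b, c, by rw [hq]; push_cast; linarith, fun x hx => (habc x hx).trans ?_⟩
  have hq0 : (0 : ℝ) < q := by rw [hq]; positivity
  rw [div_le_iff₀ (Real.sqrt_pos.mpr hq0), mul_one, ← hβ]
  refine abs_le_of_sq_le_sq' ?_ (by positivity) |>.2
  rw [mul_pow, mul_pow, Real.sq_sqrt hq0.le]
  rw [div_le_iff₀ (by positivity)] at hceil
  rw [hq]; push_cast
  nlinarith [sq_nonneg δ]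

/-- The precision units recover an integer valued function exactly through an affine readout. -/
structure MemoryReadout {d : ℕ} (type : RPEType) (S : Set (Token d)) (g : Token d → ℕ)
    (q : ℕ) where
  J : ℕ
  a : Fin q → Fin J → ℝ
  b : Fin q → Fin d → ℝ
  c : Fin q → ℝ
  bias : ℝ
  coef : Fin J → ℝ
  bound : ℝ
  defined : ∀ x ∈ S, ∀ j, type.PrecisionDefined (∑ k, a k j * relu (∑ i, b k i * x i + c k))
  bounded : ∀ x ∈ S, ∀ j, |type.precision (∑ k, a k j * relu (∑ i, b k i * x i + c k))| ≤ bound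
  readout : ∀ x ∈ S,
    bias + ∑ j, coef j * type.precision (∑ k, a k j * relu (∑ i, b k i * x i + c k)) = g x

/-- The width needed to recover a memory function exactly. -/
def RPEType.memoryWidth {d : ℕ} (type : RPEType) (S : Set (Token d)) (g : Token d → ℕ) (T : ℕ) :
    ℝ≥0∞ :=
  match type with
  | .lin => barronNorm S (fun x => (g x : ℝ)) ^ 2
  | .log => barronNorm S (fun x => Real.log (g x)) ^ 2 * (T : ℝ≥0∞) ^ 2

/-- An approximation within `1 / 4` rounds to the exact integer. The surplus of two neurons is
absorbed because `g ≥ 1` forces the Barron norm to be at least `1 / 2`. -/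
theorem exists_memoryReadout_lin {d : ℕ} {S : Set (Token d)} (hS : ∀ x ∈ S, ‖x‖ ≤ 1)
    (hne : S.Nonempty) {g : Token d → ℕ} {T : ℕ} (hg : ∀ x ∈ S, 1 ≤ g x) (hT : ∀ x ∈ S, g x ≤ T)
    (hf : barronNorm S (fun x => (g x : ℝ)) ≠ ∞) :
    ∃ q : ℕ, (q : ℝ) ≤ 60000 * (barronNorm S (fun x => (g x : ℝ))).toReal ^ 2 ∧
      Nonempty (MemoryReadout .lin S g q) := by
  obtain ⟨q, a, b, c, hq, habc⟩ := exists_network_error_le hS hf (show (0 : ℝ) < 1 / 4 by norm_num)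
  obtain ⟨x₀, hx₀⟩ := hne
  have hβ := abs_le_barronNorm hf le_rfl hx₀ (hS x₀ hx₀)
  have h1 : (1 : ℝ) ≤ g x₀ := by exact_mod_cast hg x₀ hx₀
  rw [abs_of_nonneg (by linarith)] at hβ
  have hround : ∀ x ∈ S, RPEType.lin.precision (∑ k, a k * relu (∑ i, b k i * x i + c k)) = g x :=
    fun x hx => by
      have : round (∑ k, a k * relu (∑ i, b k i * x i + c k)) = (g x : ℤ) := by
        apply round_eq_of_abs_sub_lt
        rw [abs_sub_comm]
        exact (habc x hx).trans_lt (by norm_num)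
      simp [RPEType.precision, this]
  refine ⟨q, ?_, ⟨⟨1, fun k _ => a k, b, c, 0, fun _ => 1, T, fun _ _ _ => trivial,
    fun x hx j => ?_, fun x hx => ?_⟩⟩⟩
  · norm_num at hq hβ
    nlinarith
  · rw [hround x hx, abs_of_nonneg (Nat.cast_nonneg _)]
    exact_mod_cast hT x hx
  · simp [hround x hx]

/-- The precision unit `log [exp ·]` applied to a scaled approximation of `log g` is a threshold. -/
theorem precision_log_threshold {T g k : ℕ} {F : ℝ} (hg : 1 ≤ g) (hgT : g ≤ T) (hk : 1 ≤ k)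
    (hkT : k ≤ T) (hF : |Real.log g - F| ≤ 1 / (4 * T)) :
    RPEType.log.PrecisionDefined
        ((10 * T : ℝ)⁻¹ * (F - Real.log (k - 1 / 2)) + Real.log (3 / 2)) ∧
      RPEType.log.precision ((10 * T : ℝ)⁻¹ * (F - Real.log (k - 1 / 2)) + Real.log (3 / 2)) =
        if k ≤ g then Real.log 2 else 0 := by
  have hg0 : (1 : ℝ) ≤ g := by exact_mod_cast hg
  have hgT' : (g : ℝ) ≤ T := by exact_mod_cast hgT
  have hk0 : (1 : ℝ) ≤ k := by exact_mod_cast hk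
  have hkT' : (k : ℝ) ≤ T := by exact_mod_cast hkT
  have hT0 : (1 : ℝ) ≤ T := hg0.trans hgT'
  have hTpos : (0 : ℝ) < T := by linarith
  obtain ⟨hF1, hF2⟩ := abs_le.mp hF
  have hT4 : 1 / (4 * (T : ℝ)) ≤ 1 / 4 := by
    rw [div_le_div_iff₀ (by positivity) (by norm_num)]; linarith
  set τ := Real.log ((k : ℝ) - 1 / 2) with hτ
  set u := (10 * T : ℝ)⁻¹ * (F - τ) with hu
  have hlogg1 : Real.log g ≤ g - 1 := Real.log_le_sub_one_of_pos (by linarith)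
  have hlogg0 : 0 ≤ Real.log g := Real.log_nonneg hg0
  have hτ1 : τ ≤ k - 1 / 2 - 1 := Real.log_le_sub_one_of_pos (by linarith)
  have hτ0 : -1 ≤ τ := by
    have h1 : Real.log (1 / 2) ≤ τ := Real.log_le_log (by norm_num) (by linarith)
    have h2 := Real.one_sub_inv_le_log_of_pos (show (0 : ℝ) < 1 / 2 by norm_num)
    norm_num at h1 h2 ⊢
    linarith
  have hu1 : |u| ≤ 1 / 4 := by
    rw [hu, abs_mul, abs_of_pos (by positivity), inv_mul_le_iff₀ (by positivity), abs_le]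
    constructor <;> linarith
  obtain ⟨hul, hur⟩ := abs_le.mp hu1
  have hexp : Real.exp (u + Real.log (3 / 2)) = Real.exp u * (3 / 2) := by
    rw [Real.exp_add, Real.exp_log (by norm_num)]
  have hupper : Real.exp u ≤ 4 / 3 := by
    have := Real.add_one_le_exp (-u)
    rw [Real.exp_neg, le_inv_comm₀ (by linarith) (Real.exp_pos u)] at this
    refine this.trans ?_
    rw [inv_le_comm₀ (by linarith) (by norm_num)]
    linarith
  have hlower : 3 / 4 ≤ Real.exp u := by
    have := Real.add_one_le_exp u
    linarith
  by_cases hkg : k ≤ g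
  · have hkg' : (k : ℝ) ≤ g := by exact_mod_cast hkg
    have hsep : τ ≤ F := by
      have h1 : τ ≤ Real.log (g - 1 / 2) := Real.log_le_log (by linarith) (by linarith)
      have h2 := Real.log_le_sub_one_of_pos
        (show 0 < ((g : ℝ) - 1 / 2) / g from div_pos (by linarith) (by linarith))
      rw [Real.log_div (by linarith) (by linarith)] at h2
      have h3 : ((g : ℝ) - 1 / 2) / g - 1 ≤ -(1 / (4 * T)) := by
        rw [div_sub_one (by linarith), ← neg_div, div_le_div_iff₀ (by linarith) (by linarith)]
        linarith
      linarith
    -- The scale `1 / (10T)` confines `exp u * (3 / 2)` to `[9 / 8, 2]`, so rounding gives `1` or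
    -- `2`. The tie `u = 0` belongs to this case because `3 / 2` rounds up.
    have hu0 : 0 ≤ u := mul_nonneg (by positivity) (by linarith)
    have hround : round (Real.exp (u + Real.log (3 / 2))) = 2 := by
      rw [round_eq_iff, hexp]
      have := Real.one_le_exp hu0
      constructor <;> push_cast <;> linarith
    simp [RPEType.PrecisionDefined, RPEType.precision, hround, hkg]
  · have hgk : (g : ℝ) + 1 ≤ k := by exact_mod_cast not_le.mp hkg
    have hsep : F < τ := by
      have h1 : Real.log (g + 1 / 2) ≤ τ := Real.log_le_log (by linarith) (by linarith)
      have h2 := Real.log_le_sub_one_of_pos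
        (show 0 < (g : ℝ) / (g + 1 / 2) from div_pos (by linarith) (by linarith))
      rw [Real.log_div (by linarith) (by linarith)] at h2
      have h3 : (g : ℝ) / (g + 1 / 2) - 1 < -(1 / (4 * T)) := by
        rw [div_sub_one (by linarith), ← neg_div, div_lt_div_iff₀ (by linarith) (by linarith)]
        linarith
      linarith
    have hu0 : u < 0 := mul_neg_of_pos_of_neg (by positivity) (by linarith)
    have hround : round (Real.exp (u + Real.log (3 / 2))) = 1 := by
      rw [round_eq_iff, hexp]
      have := Real.exp_lt_one_iff.mpr hu0
      constructor <;> push_cast <;> linarith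
    simp [RPEType.PrecisionDefined, RPEType.precision, hround, hkg]

theorem sum_threshold {T g : ℕ} (hgT : g ≤ T) :
    ∑ j : Fin T, (if (j : ℕ) + 1 ≤ g then (1 : ℝ) else 0) = g := by
  rw [Fin.sum_univ_eq_sum_range (fun j => if j + 1 ≤ g then (1 : ℝ) else 0), Finset.sum_boole]
  congr 1
  rw [show {j ∈ Finset.range T | j + 1 ≤ g} = Finset.range g by
    ext j; simp only [Finset.mem_filter, Finset.mem_range]; omega, Finset.card_range]

/-- An affine readout cannot exponentiate `log g`, so `g` is recovered as the number of thresholds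
`k ≤ T` that it reaches. All `T` threshold units share the same hidden neurons and differ only in
outer weights. The factor `T²` in the width comes solely from the accuracy `1 / (4T)` needed to
separate consecutive logarithms. -/
theorem exists_memoryReadout_log {d : ℕ} {S : Set (Token d)} (hS : ∀ x ∈ S, ‖x‖ ≤ 1)
    {g : Token d → ℕ} {T : ℕ} (hT1 : 1 ≤ T) (hg : ∀ x ∈ S, 1 ≤ g x) (hT : ∀ x ∈ S, g x ≤ T)
    (hf : barronNorm S (fun x => Real.log (g x)) ≠ ∞) :
    ∃ q : ℕ, (q : ℝ) ≤ 60000 *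
      ((barronNorm S (fun x => Real.log (g x))).toReal ^ 2 * (T : ℝ) ^ 2) ∧
      Nonempty (MemoryReadout .log S g q) := by
  set β := (barronNorm S (fun x => Real.log (g x))).toReal with hβdef
  -- When `g = 1` throughout, `log g` has Barron norm zero and no neuron is allowed; the bias alone
  -- reads `1`. Otherwise a value `log g ≥ log 2` bounds the norm below.
  by_cases hone : ∀ x ∈ S, g x = 1
  · refine ⟨0, by rw [Nat.cast_zero]; positivity, ⟨⟨0, fun _ _ => 0, fun _ _ => 0, fun _ => 0, 1,
      fun _ => 0, 0, fun _ _ j => j.elim0, fun _ _ j => j.elim0, fun x hx => by simp [hone x hx]⟩⟩⟩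
  · push Not at hone
    obtain ⟨x₀, hx₀, hne⟩ := hone
    have hg2 : 2 ≤ g x₀ := by have := hg x₀ hx₀; omega
    have hT2 : (2 : ℝ) ≤ T := by exact_mod_cast hg2.trans (hT x₀ hx₀)
    have hβ := abs_le_barronNorm hf le_rfl hx₀ (hS x₀ hx₀)
    have hlog2 : Real.log 2 ≤ Real.log (g x₀) :=
      Real.log_le_log (by norm_num) (by exact_mod_cast hg2)
    have hl2 := Real.log_two_gt_d9
    have hβ' : 0.34 ≤ β := by
      have := (le_abs_self _).trans hβ
      norm_num at this hl2 ⊢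
      linarith
    have hTpos : (0 : ℝ) < T := by linarith
    obtain ⟨q, a, b, c, hq, habc⟩ := exists_network_error_le hS hf
      (show (0 : ℝ) < 1 / (4 * T) by positivity)
    set lam : ℝ := (10 * T : ℝ)⁻¹ with hlam
    set F : Token d → ℝ := fun x => ∑ k, a k * relu (∑ i, b k i * x i + c k) with hF
    -- The extra neuron is the constant `σ(1) = 1`, which supplies the offset of each threshold,
    -- since the network has no output bias.
    let a' : Fin (q + 1) → Fin T → ℝ := Fin.cons
      (fun j => -(lam * Real.log (((j + 1 : ℕ) : ℝ) - 1 / 2)) + Real.log (3 / 2))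
      (fun k _ => lam * a k)
    let b' : Fin (q + 1) → Fin d → ℝ := Fin.cons 0 b
    let c' : Fin (q + 1) → ℝ := Fin.cons 1 c
    have hnet : ∀ x (j : Fin T), ∑ k, a' k j * relu (∑ i, b' k i * x i + c' k) =
        lam * (F x - Real.log (((j + 1 : ℕ) : ℝ) - 1 / 2)) + Real.log (3 / 2) := by
      intro x j
      rw [Fin.sum_univ_succ]
      simp only [a', b', c', Fin.cons_zero, Fin.cons_succ, Pi.zero_apply, zero_mul,
        Finset.sum_const_zero, zero_add, hF]
      simp_rw [mul_assoc]
      rw [← Finset.mul_sum]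
      simp only [relu, zero_le_one, max_eq_left]
      ring
    have hthr := fun x (hx : x ∈ S) (j : Fin T) => precision_log_threshold (k := j + 1) (hg x hx)
      (hT x hx) (by omega) (by omega) (habc x hx)
    refine ⟨q + 1, ?_, ⟨⟨T, a', b', c', 0, fun _ => (Real.log 2)⁻¹, Real.log 2, fun x hx j => ?_,
      fun x hx j => ?_, fun x hx => ?_⟩⟩⟩
    · have e : 1600 * β ^ 2 / (1 / (4 * (T : ℝ))) ^ 2 = 25600 * (β ^ 2 * T ^ 2) := by
        field_simp; norm_num
      rw [e] at hq
      have h1 : (0.34 : ℝ) ^ 2 * 2 ^ 2 ≤ β ^ 2 * T ^ 2 := by gcongr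
      push_cast
      norm_num at h1
      linarith
    · rw [hnet]; exact (hthr x hx j).1
    · rw [hnet, (hthr x hx j).2]
      have : 0 ≤ Real.log 2 := Real.log_nonneg (by norm_num)
      split_ifs <;> simp [this, abs_of_nonneg]
    · have h2 : Real.log 2 ≠ 0 := by linarith
      rw [zero_add, ← sum_threshold (hT x hx)]
      refine Finset.sum_congr rfl fun j _ => ?_
      rw [hnet, (hthr x hx j).2]
      split_ifs <;> simp [h2]

theorem exists_memoryReadout (type : RPEType) {d : ℕ} {S : Set (Token d)}
    (hS : ∀ x ∈ S, ‖x‖ ≤ 1) (hne : S.Nonempty) {g : Token d → ℕ} {T : ℕ}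
    (hg : ∀ x ∈ S, 1 ≤ g x) (hT : ∀ x ∈ S, g x ≤ T) (hw : type.memoryWidth S g T ≠ ∞) :
    ∃ q : ℕ, (q : ℝ≥0∞) ≤ ENNReal.ofReal 60000 * type.memoryWidth S g T ∧
      Nonempty (MemoryReadout type S g q) := by
  obtain ⟨x₀, hx₀⟩ := id hne
  have hT1 : 1 ≤ T := (hg x₀ hx₀).trans (hT x₀ hx₀)
  cases type
  · simp only [RPEType.memoryWidth] at hw ⊢
    have hf : barronNorm S (fun x => (g x : ℝ)) ≠ ∞ := fun h => hw (by simp [h])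
    obtain ⟨q, hq, hr⟩ := exists_memoryReadout_lin hS hne hg hT hf
    refine ⟨q, ?_, hr⟩
    rw [← ENNReal.ofReal_toReal hf, ← ENNReal.ofReal_pow ENNReal.toReal_nonneg,
      ← ENNReal.ofReal_mul (by norm_num), ← ENNReal.ofReal_natCast]
    exact ENNReal.ofReal_le_ofReal hq
  · simp only [RPEType.memoryWidth] at hw ⊢
    -- Needed because `∞ * 0 = 0`: a finite width bound alone would not make the Barron norm finite.
    have hT0 : (T : ℝ≥0∞) ^ 2 ≠ 0 := by
      have : (T : ℝ≥0∞) ≠ 0 := by exact_mod_cast (by omega : T ≠ 0)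
      exact pow_ne_zero 2 this
    have hf : barronNorm S (fun x => Real.log (g x)) ≠ ∞ := fun h =>
      hw (by rw [h, ENNReal.top_pow two_ne_zero, ENNReal.top_mul hT0])
    obtain ⟨q, hq, hr⟩ := exists_memoryReadout_log hS hT1 hg hT hf
    refine ⟨q, ?_, hr⟩
    rw [← ENNReal.ofReal_toReal hf, ← ENNReal.ofReal_natCast T,
      ← ENNReal.ofReal_pow ENNReal.toReal_nonneg, ← ENNReal.ofReal_pow (Nat.cast_nonneg T),
      ← ENNReal.ofReal_mul (by positivity),
      ← ENNReal.ofReal_mul (by norm_num), ← ENNReal.ofReal_natCast]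
    exact ENNReal.ofReal_le_ofReal hq

/-! ### Geometry of concatenated tokens -/

theorem norm_sq_concat {d M : ℕ} (z : EuclideanSpace ℝ (Fin (M + 1) × Fin d)) :
    ‖z‖ ^ 2 = ∑ k, ‖(WithLp.toLp 2 (fun i => z (k, i)) : Token d)‖ ^ 2 := by
  simp only [EuclideanSpace.norm_sq_eq, Fintype.sum_prod_type]

theorem norm_le_of_mem_ballProduct {d M : ℕ} {z : EuclideanSpace ℝ (Fin (M + 1) × Fin d)}
    (hz : z ∈ ballProduct d M) : ‖z‖ ≤ Real.sqrt ((M + 1 : ℕ) : ℝ) := by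
  apply Real.le_sqrt_of_sq_le
  rw [norm_sq_concat]
  calc _ ≤ ∑ k : Fin (M + 1), (1 : ℝ) :=
        Finset.sum_le_sum fun k _ => pow_le_one₀ (norm_nonneg _) (hz k)
    _ = _ := by simp

theorem dist_concatTokens_le {d M : ℕ} (u v : Fin (M + 1) → Token d) :
    dist (concatTokens u) (concatTokens v) ≤ ∑ k, ‖u k - v k‖ := by
  rw [dist_eq_norm]
  refine abs_le_of_sq_le_sq' ?_ (by positivity) |>.2
  rw [norm_sq_concat]
  exact Finset.sum_sq_le_sq_sum_of_nonneg fun _ _ => norm_nonneg _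

theorem concatTokens_mem_ballProduct {d M : ℕ} {u : Fin (M + 1) → Token d}
    (hu : ∀ k, ‖u k‖ ≤ 1) : concatTokens u ∈ ballProduct d M := hu

theorem ofReal_abs_sub_le_lipNorm {ι : Type*} [Fintype ι] {S : Set (EuclideanSpace ℝ ι)}
    {f : EuclideanSpace ℝ ι → ℝ} {x y : EuclideanSpace ℝ ι} (hx : x ∈ S) (hy : y ∈ S) :
    ENNReal.ofReal |f x - f y| ≤ lipNorm S f * ENNReal.ofReal (dist x y) := by
  rw [← Real.dist_eq, ← edist_dist, ← edist_dist]
  rcases eq_or_ne (edist x y) 0 with h0 | h0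
  · rw [edist_eq_zero] at h0
    simp [h0]
  · rw [← ENNReal.div_le_iff_le_mul (Or.inl h0) (Or.inl (edist_ne_top x y))]
    refine le_iInf₂ fun K hK => ?_
    rw [ENNReal.div_le_iff_le_mul (Or.inl h0) (Or.inl (edist_ne_top x y))]
    exact hK hx hy

theorem norm_tsum_smul_le {E : Type*} [NormedAddCommGroup E] [NormedSpace ℝ E] [CompleteSpace E]
    {w : ℕ → ℝ} (hw : Summable w) {x : ℕ → E} (hx : ∀ s, ‖x s‖ ≤ 1) :
    Summable (fun s => w s • x s) ∧ ‖∑' s, w s • x s‖ ≤ ∑' s, |w s| := by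
  have hb : ∀ s, ‖w s • x s‖ ≤ |w s| := fun s => by
    rw [norm_smul, Real.norm_eq_abs]
    exact mul_le_of_le_one_right (abs_nonneg _) (hx s)
  exact ⟨Summable.of_norm_bounded hw.abs hb, tsum_of_norm_bounded hw.abs.hasSum hb⟩

/-! ### The attention weights -/

theorem tmxWeight_eq {D : ℕ} (type : RPEType) (q : TMXScoreParams D) (y : Fin D → ℝ) (s : ℕ)
    {g : ℝ} (hp : 0 < q.1) (hg : 1 ≤ g) (hy : q.2 ⬝ᵥ y = g) :
    tmxWeight type q y s = type.kernelBase g s ^ q.1 := by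
  have hg0 : 0 < g := by linarith
  unfold tmxWeight tmxScore
  rw [hy]
  cases type
  · have hs : (0 : ℝ) ≤ s := Nat.cast_nonneg s
    simp only [RPEType.phi, if_pos hs, if_pos hg0.le, RPEType.kernelBase]
    rw [← EReal.coe_sub, ← EReal.coe_mul, EReal.exp_coe,
      ENNReal.toReal_ofReal (Real.exp_pos _).le, ← Real.exp_mul]
    congr 1; ring
  · simp only [RPEType.phi, if_pos hg, RPEType.kernelBase]
    rcases Nat.eq_zero_or_pos s with rfl | hs
    -- At lag `0` the score is `-∞` and the weight `0`. The convention `g / 0 = 0` gives the kernel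
    -- the same value.
    · rw [Nat.cast_zero, if_neg (by norm_num), EReal.bot_sub, EReal.coe_mul_bot_of_pos hp,
        EReal.exp_bot, div_zero, Real.zero_rpow hp.ne']
      rfl
    · have hs1 : (1 : ℝ) ≤ s := by exact_mod_cast hs
      rw [if_pos hs1, ← EReal.coe_sub, ← EReal.coe_mul, EReal.exp_coe,
        ENNReal.toReal_ofReal (Real.exp_pos _).le, Real.rpow_def_of_pos (by positivity),
        Real.log_div (by positivity) (by positivity)]
      congr 1; ring

theorem phi_ne_bot (type : RPEType) {g : ℝ} (hg : 1 ≤ g) : type.phi g ≠ ⊥ := by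
  cases type
  · simp only [RPEType.phi, if_pos (zero_le_one.trans hg)]
    exact EReal.coe_ne_bot _
  · simp only [RPEType.phi, if_pos hg]
    exact EReal.coe_ne_bot _

theorem RPEType.precision_zero (type : RPEType) : type.precision 0 = 0 := by
  cases type <;> simp [RPEType.precision]

theorem RPEType.precisionDefined_zero (type : RPEType) : type.PrecisionDefined 0 := by
  cases type <;> simp [RPEType.PrecisionDefined]

/-! ### Assembly of the Transformer -/

/-- All the data from which the Transformer is assembled. -/
structure TMXBlueprint (type : RPEType) (d M H m : ℕ) (S : Set (Token d))
    (g : Fin M → Token d → ℕ) where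
  q : Fin M → ℕ
  memory : ∀ i, MemoryReadout type S (g i) (q i)
  slot : (Σ i, Fin (q i)) ↪ Fin m
  own : Fin H → Option (Fin M)
  p : Fin H → ℝ
  α : Fin M → Fin H → ℝ
  a : Fin m → ℝ
  b : Fin m → Fin (M + 1) × Fin d → ℝ
  c : Fin m → ℝ

namespace TMXBlueprint

variable {type : RPEType} {d M H m : ℕ} {S : Set (Token d)} {g : Fin M → Token d → ℕ}
  (P : TMXBlueprint type d M H m S g)

/-- The coordinates of the embedding: a constant, `M + 1` token slots, the precision units. -/
abbrev Coord : Type := Unit ⊕ (Fin (M + 1) × Fin d) ⊕ (Σ i, Fin (P.memory i).J)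

/-- The embedding dimension. -/
abbrev D : ℕ := Fintype.card P.Coord

/-- Vectors indexed by named coordinates, as vectors of the embedding space. -/
def vec (y : P.Coord → ℝ) : Fin P.D → ℝ := fun j => y ((Fintype.equivFin P.Coord).symm j)

/-- The position of a named coordinate. -/
def pos (x : P.Coord) : Fin P.D := Fintype.equivFin P.Coord x

@[simp] theorem vec_pos (y : P.Coord → ℝ) (x : P.Coord) : P.vec y (P.pos x) = y x := by
  simp [vec, pos]

theorem pos_surjective (j : Fin P.D) : ∃ x, P.pos x = j :=
  (Fintype.equivFin P.Coord).surjective j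

theorem vec_dotProduct (u : P.Coord → ℝ) (y : Fin P.D → ℝ) :
    P.vec u ⬝ᵥ y = ∑ x, u x * y (P.pos x) := by
  rw [dotProduct, ← (Fintype.equivFin P.Coord).sum_comp]
  simp [vec, pos]

/-- A coordinate vector given by its constant, slot, and precision parts. -/
def parts (k : ℝ) (z : Fin (M + 1) × Fin d → ℝ) (τ : (Σ i, Fin (P.memory i).J) → ℝ) :
    P.Coord → ℝ :=
  Sum.elim (fun _ => k) (Sum.elim z τ)

theorem vec_parts_dotProduct (k : ℝ) (z : Fin (M + 1) × Fin d → ℝ)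
    (τ : (Σ i, Fin (P.memory i).J) → ℝ) (y : Fin P.D → ℝ) :
    P.vec (P.parts k z τ) ⬝ᵥ y = k * y (P.pos (Sum.inl ())) +
      (∑ kc, z kc * y (P.pos (Sum.inr (Sum.inl kc))) +
        ∑ σ, τ σ * y (P.pos (Sum.inr (Sum.inr σ)))) := by
  rw [vec_dotProduct, Fintype.sum_sum_type, Fintype.sum_sum_type]
  simp [parts]

/-- The slots of a single current token. -/
def tokenSlots (u : Token d) : Fin (M + 1) × Fin d → ℝ :=
  fun kc => if kc.1 = 0 then u kc.2 else 0

/-- The pre-activation of the precision unit `σ` at the token `u`. -/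
def unitInput (u : Token d) (σ : Σ i, Fin (P.memory i).J) : ℝ :=
  ∑ k, (P.memory σ.1).a k σ.2 * relu (∑ i, (P.memory σ.1).b k i * u i + (P.memory σ.1).c k)

/-- The assembled Transformer. -/
def transformer : TMXTransformer d P.D H m where
  WE := Matrix.of fun j c => P.vec (P.parts 0 (fun kc => if kc = (0, c) then 1 else 0) 0) j
  bE := P.vec (P.parts 1 0 0)
  attn₁ :=
    -- The first attention contributes nothing. Its scores read the constant coordinate, with an
    -- exponent for which the sums converge.
    { score := fun _ => (2, P.vec (P.parts 1 0 0))
      WV := fun _ => 0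
      WO := 0 }
  ffn₁ :=
    { a := fun h => P.vec (P.parts 0 0 fun τ => (Function.partialInv P.slot h).elim 0 fun σ =>
        if e : σ.1 = τ.1 then (P.memory τ.1).a (e ▸ σ.2) τ.2 else 0)
      b := fun h => P.vec (P.parts 0 (fun kc => (Function.partialInv P.slot h).elim 0 fun σ =>
        if kc.1 = 0 then (P.memory σ.1).b σ.2 kc.2 else 0) 0)
      c := fun h => (Function.partialInv P.slot h).elim 0 fun σ => (P.memory σ.1).c σ.2 }
  attn₂ :=
    { score := fun h => (P.p h, P.vec ((P.own h).elim (P.parts 1 0 0) fun i =>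
        P.parts (P.memory i).bias 0 fun σ => if σ.1 = i then (P.memory σ.1).coef σ.2 else 0))
      -- Head `h` copies slot `0` of past tokens into slot `i + 1` with factor `α i h`. The `0` in
      -- `Fin.cases` keeps the current token in slot `0` intact.
      WV := fun h => Matrix.of fun j => P.vec (P.parts 0 (fun kc =>
        P.vec (P.parts 0 (fun kc' => if kc = (0, kc'.2) then
          Fin.cases 0 (fun i => P.α i h) kc'.1 else 0) 0) j) 0)
      WO := 1 }
  ffn₂ :=
    { a := fun k _ => P.a k
      b := fun k => P.vec (P.parts 0 (P.b k) 0)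
      c := P.c }

theorem x0_eq (X : TokenSeq d) (t : ℤ) :
    P.transformer.x0 X t = P.vec (P.parts 1 (tokenSlots (X t)) 0) := by
  funext j
  obtain ⟨x, rfl⟩ := P.pos_surjective j
  simp only [TMXTransformer.x0, transformer, Pi.add_apply, Matrix.mulVec, dotProduct,
    Matrix.of_apply, vec_pos]
  rcases x with _ | ⟨⟨k, c⟩ | σ⟩
  · simp [parts]
  · simp only [parts, Sum.elim_inr, Sum.elim_inl, Pi.zero_apply, add_zero, tokenSlots,
      Prod.mk.injEq, ite_mul, one_mul, zero_mul]
    by_cases hk : k = 0 <;> simp [hk]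
  · simp [parts]

theorem xHalf_eq (X : TokenSeq d) (t : ℤ) :
    P.transformer.xHalf type X t = P.vec (P.parts 1 (tokenSlots (X t)) 0) := by
  rw [TMXTransformer.xHalf, x0_eq]
  simp [TMXAttn.eval, transformer]

theorem sum_mul_tokenSlots (u : Token d) (z : Fin (M + 1) × Fin d → ℝ) :
    ∑ kc, z kc * tokenSlots u kc = ∑ c, z (0, c) * u c := by
  rw [Fintype.sum_prod_type, Finset.sum_eq_single 0]
  · simp [tokenSlots]
  · intro k _ hk; simp [tokenSlots, hk]
  · simp

theorem ffn₁_eq (u : Token d) :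
    P.transformer.ffn₁.eval (P.vec (P.parts 1 (tokenSlots u) 0)) =
      P.vec (P.parts 0 0 (P.unitInput u)) := by
  have hpre : ∀ h, P.transformer.ffn₁.b h ⬝ᵥ P.vec (P.parts 1 (tokenSlots u) 0) +
      P.transformer.ffn₁.c h = (Function.partialInv P.slot h).elim 0 fun σ =>
        ∑ i, (P.memory σ.1).b σ.2 i * u i + (P.memory σ.1).c σ.2 := by
    intro h
    simp only [transformer]
    rw [vec_parts_dotProduct]
    simp only [vec_pos, parts, Sum.elim_inr, Sum.elim_inl]
    rw [sum_mul_tokenSlots]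
    rcases Function.partialInv P.slot h with _ | σ <;> simp
  funext j
  obtain ⟨x, rfl⟩ := P.pos_surjective j
  simp only [FFN.eval, hpre, Finset.sum_apply, Pi.smul_apply, smul_eq_mul, vec_pos]
  simp only [transformer, vec_pos]
  rcases x with _ | ⟨kc | τ⟩
  · simp [parts]
  · simp [parts]
  · simp only [parts, Sum.elim_inr]
    rw [sum_partialInv P.slot (fun o => relu (o.elim 0 fun σ =>
        ∑ i, (P.memory σ.1).b σ.2 i * u i + (P.memory σ.1).c σ.2) * o.elim 0 fun σ =>
        if e : σ.1 = τ.1 then (P.memory τ.1).a (e ▸ σ.2) τ.2 else 0) (by simp),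
      Fintype.sum_sigma, Finset.sum_eq_single τ.1]
    · simp [unitInput, mul_comm]
    · intro i _ hi; simp [hi]
    · simp

theorem x1_eq (X : TokenSeq d) (t : ℤ) :
    P.transformer.x1 type X t = P.vec (P.parts 1 (tokenSlots (X t))
      fun σ => type.precision (P.unitInput (X t) σ)) := by
  rw [TMXTransformer.x1, xHalf_eq, ffn₁_eq]
  funext j
  obtain ⟨x, rfl⟩ := P.pos_surjective j
  rw [Pi.add_apply, vec_pos, vec_pos, vec_pos]
  rcases x with _ | ⟨kc | τ⟩ <;> simp [parts, type.precision_zero]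

/-- The centre of the score of a head. -/
def centre (u : Token d) (h : Fin H) : ℕ := (P.own h).elim 1 fun i => g i u

theorem score₂_eq {X : TokenSeq d} {t : ℤ} (hX : X t ∈ S) (h : Fin H) :
    (P.transformer.attn₂.score h).2 ⬝ᵥ P.transformer.x1 type X t = P.centre (X t) h := by
  rw [x1_eq]
  simp only [transformer, centre]
  rcases P.own h with _ | i
  · simp only [Option.elim_none]
    rw [vec_parts_dotProduct]
    simp [parts]
  · simp only [Option.elim_some]
    rw [vec_parts_dotProduct]
    simp only [vec_pos, parts, Sum.elim_inl, Sum.elim_inr, Pi.zero_apply, zero_mul,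
      Finset.sum_const_zero, zero_add, mul_one]
    rw [Fintype.sum_sigma, Finset.sum_eq_single i]
    · simpa [unitInput] using (P.memory i).readout _ hX
    · intro j _ hj; simp [hj]
    · simp

theorem one_le_centre (hg : ∀ i, ∀ x ∈ S, 1 ≤ g i x) {u : Token d} (hu : u ∈ S) (h : Fin H) :
    1 ≤ P.centre u h := by
  unfold centre
  rcases P.own h with _ | i
  · exact le_rfl
  · exact hg i u hu

theorem weight₂_eq (hp : ∀ h, 0 < P.p h) (hg : ∀ i, ∀ x ∈ S, 1 ≤ g i x) {X : TokenSeq d} {t : ℤ}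
    (hX : X t ∈ S) (h : Fin H) (s : ℕ) :
    tmxWeight type (P.transformer.attn₂.score h) (P.transformer.x1 type X t) s =
      type.kernelBase (P.centre (X t) h) s ^ P.p h :=
  tmxWeight_eq type _ _ s (hp h) (by exact_mod_cast P.one_le_centre hg hX h) (P.score₂_eq hX h)

theorem summable_smul_vec {w : ℕ → ℝ} (hw : Summable w) (y : ℕ → Fin P.D → ℝ) (B : ℝ)
    (hy : ∀ s j, |y s j| ≤ B) : Summable fun s => w s • y s := by
  refine Pi.summable.mpr fun j => ?_
  refine Summable.of_norm_bounded (hw.abs.mul_right B) fun s => ?_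
  rw [Pi.smul_apply, smul_eq_mul, norm_mul, Real.norm_eq_abs, Real.norm_eq_abs]
  gcongr
  exact hy s j

theorem abs_tokenSlots_le {u : Token d} (hu : ‖u‖ ≤ 1) (kc : Fin (M + 1) × Fin d) :
    |tokenSlots u kc| ≤ 1 := by
  unfold tokenSlots
  split_ifs
  · exact (PiLp.norm_apply_le u kc.2).trans hu
  · simp

theorem abs_x1_le (hS : ∀ x ∈ S, ‖x‖ ≤ 1) : ∃ B : ℝ, ∀ (X : TokenSeq d) (t : ℤ), X t ∈ S →
    ∀ j, |P.transformer.x1 type X t j| ≤ B := by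
  refine ⟨1 + ∑ i, |(P.memory i).bound|, fun X t hX j => ?_⟩
  have h0 : 0 ≤ ∑ i, |(P.memory i).bound| := Finset.sum_nonneg fun i _ => abs_nonneg _
  obtain ⟨x, rfl⟩ := P.pos_surjective j
  rw [x1_eq, vec_pos]
  rcases x with _ | ⟨kc | ⟨i, j⟩⟩
  · simpa [parts] using h0
  · have := abs_tokenSlots_le (hS _ hX) kc
    simp only [parts, Sum.elim_inr, Sum.elim_inl]
    linarith
  · simp only [parts, Sum.elim_inr]
    have h1 := (P.memory i).bounded _ hX j
    have h2 : |(P.memory i).bound| ≤ ∑ i, |(P.memory i).bound| :=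
      Finset.single_le_sum (f := fun i => |(P.memory i).bound|) (fun _ _ => abs_nonneg _)
        (Finset.mem_univ i)
    have h3 := le_abs_self (P.memory i).bound
    refine h1.trans ?_
    linarith

theorem wellDefined {𝒳 : Set (TokenSeq d)} (hS : ∀ x ∈ S, ‖x‖ ≤ 1)
    (h𝒳 : ∀ X ∈ 𝒳, ∀ t, X t ∈ S) (hg : ∀ i, ∀ x ∈ S, 1 ≤ g i x) (hp : ∀ h, 0 < P.p h)
    (hsum : ∀ h (r : ℝ), 0 ≤ r → Summable (fun s : ℕ => type.kernelBase r s ^ P.p h)) :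
    P.transformer.WellDefined type 𝒳 := by
  intro X hX t
  refine ⟨fun h => ?_, fun j => ?_, fun h => ?_⟩
  · have hdot : (P.transformer.attn₁.score h).2 ⬝ᵥ P.transformer.x0 X t = 1 := by
      rw [x0_eq]
      simp only [transformer]
      rw [vec_parts_dotProduct]
      simp [parts]
    refine ⟨two_pos, by rw [hdot]; exact phi_ne_bot type le_rfl, ?_⟩
    simp_rw [tmxWeight_eq type (P.transformer.attn₁.score h) (P.transformer.x0 X t) _
      (by exact two_pos) le_rfl hdot]
    refine P.summable_smul_vec (type.summable_kernelBase zero_le_one one_lt_two) _ 1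
      fun s j => ?_
    obtain ⟨x, rfl⟩ := P.pos_surjective j
    rw [x0_eq, vec_pos]
    rcases x with _ | ⟨kc | σ⟩
    · simp [parts]
    · exact abs_tokenSlots_le (hS _ (h𝒳 X hX _)) kc
    · simp [parts]
  · rw [xHalf_eq, ffn₁_eq]
    obtain ⟨x, rfl⟩ := P.pos_surjective j
    rw [vec_pos]
    rcases x with _ | ⟨kc | σ⟩
    · exact type.precisionDefined_zero
    · exact type.precisionDefined_zero
    · exact (P.memory σ.1).defined _ (h𝒳 X hX t) σ.2
  · obtain ⟨B, hB⟩ := P.abs_x1_le hS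
    have hXt := h𝒳 X hX t
    refine ⟨hp h, ?_, ?_⟩
    · rw [P.score₂_eq hXt]
      exact phi_ne_bot type (by exact_mod_cast P.one_le_centre hg hXt h)
    · simp_rw [P.weight₂_eq hp hg hXt]
      exact P.summable_smul_vec (hsum h _ (Nat.cast_nonneg _)) _ B
        fun s j => hB X _ (h𝒳 X hX _) j

/-- The token retrieved by the memory `i`. -/
def retrieved (X : TokenSeq d) (t : ℤ) (i : Fin M) : Token d :=
  ∑' s : ℕ, (∑ h, P.α i h * type.kernelBase (g i (X t)) s ^ P.p h) • X (t - (s : ℤ))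

theorem value₂_apply (h : Fin H) (y : Fin P.D → ℝ) (k : Fin (M + 1)) (c : Fin d) :
    (P.transformer.attn₂.WV h *ᵥ y) (P.pos (Sum.inr (Sum.inl (k, c)))) =
      Fin.cases (motive := fun _ => ℝ) 0 (fun i => P.α i h) k *
        y (P.pos (Sum.inr (Sum.inl (0, c)))) := by
  have hrow : P.transformer.attn₂.WV h (P.pos (Sum.inr (Sum.inl (k, c)))) =
      P.vec (P.parts 0 (fun kc => if kc = (0, c) then
        Fin.cases (motive := fun _ => ℝ) 0 (fun i => P.α i h) k else 0) 0) := by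
    simp only [transformer]
    funext j
    simp [parts]
  rw [Matrix.mulVec, hrow, vec_parts_dotProduct]
  simp

theorem attn₂_apply (X : TokenSeq d) (t : ℤ) (k : Fin (M + 1)) (c : Fin d) :
    P.transformer.attn₂.eval type (P.transformer.x1 type X) t (P.pos (Sum.inr (Sum.inl (k, c)))) =
      ∑ h, Fin.cases (motive := fun _ => ℝ) 0 (fun i => P.α i h) k *
        (∑' s : ℕ, tmxWeight type (P.transformer.attn₂.score h) (P.transformer.x1 type X t) s •
          P.transformer.x1 type X (t - (s : ℤ))) (P.pos (Sum.inr (Sum.inl (0, c)))) := by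
  have hWO : P.transformer.attn₂.WO = 1 := rfl
  rw [TMXAttn.eval, hWO, Matrix.one_mulVec, Finset.sum_apply]
  exact Finset.sum_congr rfl fun h _ => P.value₂_apply h _ k c

theorem x1_slot (X : TokenSeq d) (t : ℤ) (k : Fin (M + 1)) (c : Fin d) :
    P.transformer.x1 type X t (P.pos (Sum.inr (Sum.inl (k, c)))) =
      if k = 0 then X t c else 0 := by
  rw [x1_eq, vec_pos]
  rfl

theorem xThreeHalf_slot_zero (X : TokenSeq d) (t : ℤ) (c : Fin d) :
    P.transformer.xThreeHalf type X t (P.pos (Sum.inr (Sum.inl (0, c)))) = X t c := by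
  rw [TMXTransformer.xThreeHalf, Pi.add_apply, attn₂_apply, x1_slot]
  simp

/-- A head acts on slot `i + 1` only if it is owned by memory `i`, and then its centre is `g i (X
t)`. The slot was empty before, so the residual connection adds nothing to the retrieved token. -/
theorem xThreeHalf_slot_succ {𝒳 : Set (TokenSeq d)} (hS : ∀ x ∈ S, ‖x‖ ≤ 1)
    (h𝒳 : ∀ X ∈ 𝒳, ∀ t, X t ∈ S) (hg : ∀ i, ∀ x ∈ S, 1 ≤ g i x) (hp : ∀ h, 0 < P.p h)
    (hsum : ∀ h (r : ℝ), 0 ≤ r → Summable (fun s : ℕ => type.kernelBase r s ^ P.p h))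
    (hown : ∀ i h, P.α i h ≠ 0 → P.own h = some i) {X : TokenSeq d} (hX : X ∈ 𝒳) (t : ℤ)
    (i : Fin M) (c : Fin d) :
    P.transformer.xThreeHalf type X t (P.pos (Sum.inr (Sum.inl (i.succ, c)))) =
      P.retrieved X t i c := by
  have hXt := h𝒳 X hX t
  have hx : ∀ s : ℕ, ‖X (t - (s : ℤ))‖ ≤ 1 := fun s => hS _ (h𝒳 X hX _)
  have hker : ∀ h, Summable fun s : ℕ => type.kernelBase (g i (X t)) s ^ P.p h :=
    fun h => hsum h _ (Nat.cast_nonneg _)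
  have hterm : ∀ h, Summable fun s : ℕ =>
      type.kernelBase (g i (X t)) s ^ P.p h * X (t - (s : ℤ)) c := fun h => by
    have := ((norm_tsum_smul_le (hker h) hx).1).mapL (EuclideanSpace.proj (𝕜 := ℝ) c)
    simpa using this
  have hret : P.retrieved X t i c = ∑' s : ℕ, (∑ h, P.α i h *
      type.kernelBase (g i (X t)) s ^ P.p h) * X (t - (s : ℤ)) c := by
    have hs := (norm_tsum_smul_le
      (summable_sum fun h (_ : h ∈ Finset.univ) => (hker h).mul_left (P.α i h)) hx).1
    have := (EuclideanSpace.proj (𝕜 := ℝ) c).map_tsum hs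
    simpa [retrieved] using this
  rw [TMXTransformer.xThreeHalf, Pi.add_apply, attn₂_apply, x1_slot, if_neg (Fin.succ_ne_zero i),
    zero_add, hret]
  simp only [Fin.cases_succ]
  simp_rw [Finset.sum_mul, mul_assoc]
  rw [Summable.tsum_finsetSum fun h _ => (hterm h).mul_left _]
  refine Finset.sum_congr rfl fun h _ => ?_
  rw [tsum_mul_left]
  by_cases hα : P.α i h = 0
  · simp [hα]
  · have hc : P.centre (X t) h = g i (X t) := by simp [centre, hown i h hα]
    obtain ⟨B, hB⟩ := P.abs_x1_le hS
    have hsv : Summable fun s : ℕ => type.kernelBase (g i (X t)) s ^ P.p h •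
        P.transformer.x1 type X (t - (s : ℤ)) :=
      P.summable_smul_vec (hker h) _ B fun s j => hB X _ (h𝒳 X hX _) j
    simp_rw [P.weight₂_eq hp hg hXt, hc]
    rw [tsum_apply hsv]
    congr 1
    refine tsum_congr fun s => ?_
    rw [Pi.smul_apply, x1_slot, if_pos rfl, smul_eq_mul]

theorem eval_eq {𝒳 : Set (TokenSeq d)} (hS : ∀ x ∈ S, ‖x‖ ≤ 1)
    (h𝒳 : ∀ X ∈ 𝒳, ∀ t, X t ∈ S) (hg : ∀ i, ∀ x ∈ S, 1 ≤ g i x) (hp : ∀ h, 0 < P.p h)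
    (hsum : ∀ h (r : ℝ), 0 ≤ r → Summable (fun s : ℕ => type.kernelBase r s ^ P.p h))
    (hown : ∀ i h, P.α i h ≠ 0 → P.own h = some i) {X : TokenSeq d} (hX : X ∈ 𝒳) (t : ℤ) :
    P.transformer.eval type t X = ∑ k, P.a k * relu (∑ kc, P.b k kc *
      concatTokens (Fin.cons (X t) (P.retrieved X t)) kc + P.c k) := by
  have hslot : ∀ kc, P.transformer.xThreeHalf type X t (P.pos (Sum.inr (Sum.inl kc))) =
      concatTokens (Fin.cons (X t) (P.retrieved X t)) kc := by
    rintro ⟨k, c⟩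
    refine Fin.cases ?_ (fun i => ?_) k
    · exact P.xThreeHalf_slot_zero X t c
    · exact P.xThreeHalf_slot_succ hS h𝒳 hg hp hsum hown hX t i c
  rw [TMXTransformer.eval, FFN.eval, Finset.sum_apply]
  refine Finset.sum_congr rfl fun k _ => ?_
  rw [Pi.smul_apply, smul_eq_mul, mul_comm]
  have hb : P.transformer.ffn₂.b k = P.vec (P.parts 0 (P.b k) 0) := rfl
  rw [hb, vec_parts_dotProduct]
  simp only [hslot, Pi.zero_apply, zero_mul, Finset.sum_const_zero, zero_add, add_zero]
  rfl

theorem retrieved_bounds (hsum : ∀ h (r : ℝ), 0 ≤ r →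
      Summable (fun s : ℕ => type.kernelBase r s ^ P.p h)) {X : TokenSeq d} (t : ℤ)
    (hX : ∀ t, ‖X t‖ ≤ 1) (i : Fin M) {ε : ℝ}
    (h1 : ∑' s : ℕ, |∑ h, P.α i h * type.kernelBase (g i (X t)) s ^ P.p h| ≤ 1)
    (h2 : ∑' s : ℕ, |∑ h, P.α i h * type.kernelBase (g i (X t)) s ^ P.p h -
      if s = g i (X t) then 1 else 0| ≤ ε) :
    ‖P.retrieved X t i‖ ≤ 1 ∧ ‖X (t - (g i (X t) : ℤ)) - P.retrieved X t i‖ ≤ ε := by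
  have hker : Summable fun s : ℕ => ∑ h, P.α i h * type.kernelBase (g i (X t)) s ^ P.p h :=
    summable_sum fun h _ => (hsum h _ (Nat.cast_nonneg _)).mul_left (P.α i h)
  have hδ : HasSum (fun s : ℕ => if s = g i (X t) then (1 : ℝ) else 0) 1 := hasSum_ite_eq _ 1
  have hx : ∀ s : ℕ, ‖X (t - (s : ℤ))‖ ≤ 1 := fun s => hX _
  refine ⟨(norm_tsum_smul_le hker hx).2.trans h1, ?_⟩
  have hXg : ∑' s : ℕ, (if s = g i (X t) then (1 : ℝ) else 0) • X (t - (s : ℤ)) =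
      X (t - (g i (X t) : ℤ)) := by
    simp only [ite_smul, one_smul, zero_smul]
    exact tsum_ite_eq _ (fun s : ℕ => X (t - (s : ℤ)))
  rw [norm_sub_rev, ← hXg, retrieved,
    ← (norm_tsum_smul_le hker hx).1.tsum_sub (norm_tsum_smul_le hδ.summable hx).1]
  simp_rw [← sub_smul]
  exact (norm_tsum_smul_le (hker.sub hδ.summable) hx).2.trans h2

end TMXBlueprint

/-! ### The approximation theorem -/

theorem finrank_scoreParams (D : ℕ) : Module.finrank ℝ (TMXScoreParams D) = D + 1 := by
  simp [TMXScoreParams, add_comm]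

theorem AdaptiveTarget.widthBound_eq {d M : ℕ} {𝒳 : Set (TokenSeq d)} (A : AdaptiveTarget d M 𝒳)
    (type : RPEType) :
    A.widthBound type = ∑ i, type.memoryWidth (tokenSet 𝒳) (A.g i) (A.T i) := by
  cases type <;> rfl

theorem exists_transformer_of_nonempty (type : RPEType) {n : ℕ} {C : ℝ}
    (hC : ∀ (M : ℕ) (T : Fin M → ℕ) (H : ℕ), (∀ i, 1 ≤ T i) → 1 ≤ H →
      ∃ (own : Fin H → Option (Fin M)) (p : Fin H → ℝ) (α : Fin M → Fin H → ℝ) (ε : Fin M → ℝ),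
        (∀ i h, α i h ≠ 0 → own h = some i) ∧ (∀ h, 0 < p h) ∧
        (∀ h (g : ℝ), 0 ≤ g → Summable (fun s : ℕ => type.kernelBase g s ^ p h)) ∧
        ∑ i, ε i ≤ C * attnRate T H n type ∧
        ∀ i (g : ℕ), 1 ≤ g → g ≤ T i →
          ∑' s : ℕ, |∑ h, α i h * type.kernelBase g s ^ p h| ≤ 1 ∧
          ∑' s : ℕ, |∑ h, α i h * type.kernelBase g s ^ p h - if s = g then 1 else 0| ≤ ε i)
    {d M : ℕ} {𝒳 : Set (TokenSeq d)} (hX : ∀ X ∈ 𝒳, ∀ t, ‖X t‖ ≤ 1) (hne : 𝒳.Nonempty)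
    (A : AdaptiveTarget d M 𝒳) {H m : ℕ} (hH : 1 ≤ H) (hm : 1 ≤ m)
    (hwidth : ENNReal.ofReal 60000 * A.widthBound type ≤ (m : ℝ≥0∞)) :
    ∃ (D : ℕ) (N : TMXTransformer d D H m), N.WellDefined type 𝒳 ∧
      tripleNorm 𝒳 (fun t X => A.eval t X - N.eval type t X) ≤
        ENNReal.ofReal (40 * Real.sqrt ((M + 1 : ℕ) : ℝ) / Real.sqrt m) *
            barronNorm (ballProduct d M) A.f +
          lipNorm (ballProduct d M) A.f * ENNReal.ofReal (C * attnRate A.T H n type) := by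
  have hS : ∀ x ∈ tokenSet 𝒳, ‖x‖ ≤ 1 := by
    rintro _ ⟨X, hX', t, rfl⟩
    exact hX X hX' t
  have h𝒳 : ∀ X ∈ 𝒳, ∀ t, X t ∈ tokenSet 𝒳 := fun X hX' t => ⟨X, hX', t, rfl⟩
  have hSne : (tokenSet 𝒳).Nonempty := hne.elim fun X hX' => ⟨X 0, h𝒳 X hX' 0⟩
  have hT1 : ∀ i, 1 ≤ A.T i := fun i => hSne.elim fun x hx =>
    (A.one_le_g i x hx).trans (A.g_le_T i x hx)
  rw [A.widthBound_eq] at hwidth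
  have hfin : ∀ i, type.memoryWidth (tokenSet 𝒳) (A.g i) (A.T i) ≠ ∞ := fun i htop => by
    have : ∑ i, type.memoryWidth (tokenSet 𝒳) (A.g i) (A.T i) = ∞ :=
      ENNReal.sum_eq_top.mpr ⟨i, Finset.mem_univ i, htop⟩
    rw [this, ENNReal.mul_top (by simp)] at hwidth
    exact absurd hwidth (by simp)
  choose q hq hmem using fun i =>
    exists_memoryReadout type hS hSne (A.one_le_g i) (A.g_le_T i) (hfin i)
  have hqm : ∑ i, q i ≤ m := by
    have : ((∑ i, q i : ℕ) : ℝ≥0∞) ≤ m := by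
      push_cast
      refine le_trans ?_ hwidth
      rw [Finset.mul_sum]
      exact Finset.sum_le_sum fun i _ => hq i
    exact_mod_cast this
  have hcard : Fintype.card (Σ i, Fin (q i)) ≤ Fintype.card (Fin m) := by simpa using hqm
  obtain ⟨slot⟩ := Function.Embedding.nonempty_of_card_le hcard
  obtain ⟨own, p, α, ε, hown, hp, hsum, hε, hker⟩ := hC M A.T H hT1 hH
  have hR : 1 ≤ Real.sqrt ((M + 1 : ℕ) : ℝ) := by
    rw [Real.one_le_sqrt]; push_cast; linarith [(Nat.cast_nonneg M : (0 : ℝ) ≤ M)]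
  obtain ⟨a, b, c, habc⟩ := exists_network_of_barron A.f_barron hR
    (fun z hz => norm_le_of_mem_ballProduct hz) hm
  let P : TMXBlueprint type d M H m (tokenSet 𝒳) A.g :=
    { q := q, memory := fun i => (hmem i).some, slot := slot, own := own, p := p, α := α,
      a := a, b := b, c := c }
  refine ⟨P.D, P.transformer, P.wellDefined hS h𝒳 A.one_le_g hp hsum,
    iSup_le fun t => iSup₂_le fun X hX' => ?_⟩
  have hret := fun i => P.retrieved_bounds hsum t (hX X hX') i
    (hker i _ (A.one_le_g i _ (h𝒳 X hX' t)) (A.g_le_T i _ (h𝒳 X hX' t))).1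
    (hker i _ (A.one_le_g i _ (h𝒳 X hX' t)) (A.g_le_T i _ (h𝒳 X hX' t))).2
  set u : Fin (M + 1) → Token d := Fin.cons (X t) fun i => X (t - (A.g i (X t) : ℤ)) with hu
  set v : Fin (M + 1) → Token d := Fin.cons (X t) (P.retrieved X t) with hv
  have hub : concatTokens u ∈ ballProduct d M := concatTokens_mem_ballProduct fun k => by
    refine Fin.cases ?_ (fun i => ?_) k
    · exact hX X hX' t
    · exact hX X hX' _
  -- Contractivity of the kernel is used here: `f` is controlled only on the product of balls.
  have hvb : concatTokens v ∈ ballProduct d M := concatTokens_mem_ballProduct fun k => by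
    refine Fin.cases ?_ (fun i => ?_) k
    · exact hX X hX' t
    · exact (hret i).1
  have hdist : dist (concatTokens u) (concatTokens v) ≤ C * attnRate A.T H n type := by
    refine (dist_concatTokens_le u v).trans (le_trans ?_ hε)
    rw [Fin.sum_univ_succ]
    simp only [hu, hv, Fin.cons_zero, Fin.cons_succ, sub_self, norm_zero, zero_add]
    exact Finset.sum_le_sum fun i _ => (hret i).2
  have heval : P.transformer.eval type t X =
      ∑ k, a k * relu (∑ kc, b k kc * concatTokens v kc + c k) :=
    P.eval_eq hS h𝒳 A.one_le_g hp hsum hown hX' t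
  have hsplit : |A.eval t X - P.transformer.eval type t X| ≤
      40 * Real.sqrt ((M + 1 : ℕ) : ℝ) / Real.sqrt m *
        (barronNorm (ballProduct d M) A.f).toReal +
        |A.f (concatTokens u) - A.f (concatTokens v)| := by
    have h1 := habc _ hvb
    rw [← heval] at h1
    have h2 := abs_sub_le (A.f (concatTokens u)) (A.f (concatTokens v))
      (P.transformer.eval type t X)
    rw [add_comm |A.f (concatTokens u) - _|] at h2
    refine h2.trans (add_le_add (h1.trans (le_of_eq ?_)) le_rfl)
    ring
  refine (ENNReal.ofReal_le_ofReal hsplit).trans ?_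
  rw [ENNReal.ofReal_add (by positivity) (abs_nonneg _), ENNReal.ofReal_mul (by positivity),
    ENNReal.ofReal_toReal A.f_barron]
  gcongr
  exact (ofReal_abs_sub_le_lipNorm hub hvb).trans
    (mul_le_mul_right (ENNReal.ofReal_le_ofReal hdist) _)

end

theorem mainTheorem6 :
    (∀ D : ℕ, Module.finrank ℝ (TMXScoreParams D) = D + 1) ∧
    ∃ (Cwidth Cffn : ℝ) (Cattn : ℕ → ℝ), 0 < Cwidth ∧ 0 < Cffn ∧ (∀ n, 0 < Cattn n) ∧
      ∀ (type : RPEType) (d M : ℕ) (𝒳 : Set (TokenSeq d)), (∀ X ∈ 𝒳, ∀ t, ‖X t‖ ≤ 1) →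
      ∀ (A : AdaptiveTarget d M 𝒳) (n H m : ℕ), 1 ≤ n → 1 ≤ H → 1 ≤ m →
        ENNReal.ofReal Cwidth * A.widthBound type ≤ (m : ℝ≥0∞) →
        ∃ (D : ℕ) (N : TMXTransformer d D H m), N.WellDefined type 𝒳 ∧
          tripleNorm 𝒳 (fun t X => A.eval t X - N.eval type t X) ≤
            ENNReal.ofReal (Cffn * Real.sqrt ((M + 1 : ℕ) : ℝ) / Real.sqrt m) *
                barronNorm (ballProduct d M) A.f +
              lipNorm (ballProduct d M) A.f * ENNReal.ofReal (Cattn n * attnRate A.T H n type) := by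
  refine ⟨finrank_scoreParams, ?_⟩
  choose C hC halloc using fun (n : ℕ) (type : RPEType) => type.exists_head_allocation n
  -- Adding the attention constants of the two types makes one constant serve both.
  refine ⟨60000, 40, fun n => C n .lin + C n .log, by norm_num, by norm_num,
    fun n => add_pos (hC n _) (hC n _), ?_⟩
  intro type d M 𝒳 hX A n H m _ hH hm hwidth
  rcases 𝒳.eq_empty_or_nonempty with rfl | hne
  -- Without tokens nothing forces `T i ≥ 1`, but any network is vacuously well defined and has
  -- error `0`.
  · refine ⟨0, ⟨0, 0, ⟨fun _ => 0, fun _ => 0, 0⟩, ⟨0, 0, 0⟩, ⟨fun _ => 0, fun _ => 0, 0⟩,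
      ⟨0, 0, 0⟩⟩, fun X hX' => absurd hX' (Set.notMem_empty X), ?_⟩
    simp [tripleNorm]
  · obtain ⟨D, N, hN, hle⟩ := exists_transformer_of_nonempty type (halloc n type) hX hne A hH hm
      hwidth
    refine ⟨D, N, hN, hle.trans ?_⟩
    have hrate : 0 ≤ attnRate A.T H n type := by
      rw [attnRate_eq]
      have : ∀ i, 0 ≤ type.rate (A.T i) := fun i => by
        cases type
        · exact (Real.exp_pos _).le
        · exact Real.rpow_nonneg (Nat.cast_nonneg _) _
      have := Finset.sum_nonneg fun i (_ : i ∈ Finset.univ) => this i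
      positivity
    have hCle : C n type ≤ C n .lin + C n .log := by
      cases type
      · linarith [hC n .log]
      · linarith [hC n .lin]
    gcongr
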